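/- **Setting.** Let $d\ge 2$ and let $m\ge n\ge d\log d$ be integers. For $A\in\mathbb R^{d\times d}$ and a permutation $\pi\in S_d$ put $(A^\pi)_{ij}=A_{\pi(i)\pi(j)}$, and write $\langle A,B\rangle=\mathrm{Tr}(AB^\top)$, $\|A\|_F=\sqrt{\langle A,A\rangle}$ and $\|A\|_{op}$ for the Euclidean operator norm. The unknown parameters are a permutation $\pi^\star\in S_d$ and a covariance matrix $\Sigma\succ0$ with $\|\Sigma\|_{op}\le1$. In the *original model* one observes two independent samples, $X_1,\dots,X_m$ i.i.d. $N(0,\Sigma)$ and $Y_1,\dots,Y_n$ i.i.d. $N(0,\Sigma^{\pi^\star})$. In the *oracle model* one observes $Y^n=(Y_1,\dots,Y_n)$ as before and, instead of $X^m$, a (possibly random) matrix $\widehat\Sigma_m\in\mathbb R^{d\times d}$, independent of $Y^n$, of which only $\|\widehat\Sigma_m-\Sigma\|_{op}\le\sqrt{d/m}$ almost surely is known. The minimax risks are $$R_{\mathrm{or}}(d,m,n)=\inf_{\widehat\pi}\ \sup_{\pi^\star,\ \Sigma,\ \widehat\Sigma_m}\mathbb E\|\Sigma^{\widehat\pi}-\Sigma^{\pi^\star}\|_F^2,\qquad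 R(d,m,n)=\inf_{\widehat\pi}\ \sup_{\pi^\star,\ \Sigma}\mathbb E\|\Sigma^{\widehat\pi}-\Sigma^{\pi^\star}\|_F^2,$$ where the infima are over measurable functions $\widehat\pi$ of $(Y^n,\widehat\Sigma_m)$ and of $(X^m,Y^n)$ respectively, and the first supremum includes all laws of $\widehat\Sigma_m$ allowed by the oracle model. A Gromov–Wasserstein (GW) estimator in the oracle model is a measurable $\widehat\pi(Y^n,\widehat\Sigma_m)\in\operatorname{argmax}_{\pi\in S_d}\langle\widehat\Sigma_m^\pi,\widehat\Sigma_Y\rangle$ with $\widehat\Sigma_Y=\frac1n\sum_{i=1}^nY_iY_i^\top$. **Theorem.** There are absolute constants $c,C,K>0$ such that for all $d\ge2$ and $m\ge n\ge d\log d$: 1. $$c\Big(\frac{d\log d}{n}+\frac{d^2}{m}\Big)\le R_{\mathrm{or}}(d,m,n)\le C\Big(\frac{d\log d}{n}+\frac{d^2}{m}\Big).$$ 2. GW estimators exist, and each of them has worst-case risk in the oracle model (supremum over $\pi^\star$, $\Sigma$ and $\widehat\Sigma_m$ as above) at most $C\big(\frac{d\log d}{n}+\frac{d^2}{m}\big)$.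 3. The rate is strictly worse than in the original model: $R(d,m,n)\le K\,R_{\mathrm{or}}(d,m,n)$, while for equal sample sizes $\sup_{n\ge d\log d}R(d,n,n)/R_{\mathrm{or}}(d,n,n)\to0$ as $d\to\infty$. -/

import Mathlib

open MeasureTheory ProbabilityTheory
open scoped ENNReal

namespace CovAlign

/-- Data vectors in `ℝ^d`. -/
abbrev Vec (d : ℕ) : Type := EuclideanSpace ℝ (Fin d)

/-- Real `d × d` matrices. -/
abbrev Mat (d : ℕ) : Type := Matrix (Fin d) (Fin d) ℝ

/-- The entrywise (that is, Borel) `σ`-algebra on matrices. -/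
instance instMeasurableSpaceMat (d : ℕ) : MeasurableSpace (Mat d) :=
  inferInstanceAs (MeasurableSpace (Fin d → Fin d → ℝ))

/-- `A^π`, the matrix with entries `A (π i) (π j)`. -/
def permute {d : ℕ} (π : Equiv.Perm (Fin d)) (A : Mat d) : Mat d :=
  Matrix.of fun i j => A (π i) (π j)

/-- The inner product `⟨A, B⟩ = Tr (A Bᵀ)`. -/
def frobInner {d : ℕ} (A B : Mat d) : ℝ := (A * B.transpose).trace

/-- The Frobenius norm `√⟨A, A⟩`. -/
noncomputable def frobNorm {d : ℕ} (A : Mat d) : ℝ := Real.sqrt (frobInner A A)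

/-- The operator norm of `A` acting on Euclidean space. -/
noncomputable def opNorm {d : ℕ} (A : Mat d) : ℝ := ‖Matrix.toEuclideanCLM (𝕜 := ℝ) A‖

/-- The covariance matrices of the model: `Σ ≻ 0` with operator norm at most one. -/
def covSet (d : ℕ) : Set (Mat d) := {S | S.PosDef ∧ opNorm S ≤ 1}

/-- The law of `k` i.i.d. centred Gaussian vectors with covariance `S`. -/
noncomputable def sampleLaw {d : ℕ} (k : ℕ) (S : Mat d) : Measure (Fin k → Vec d) :=
  Measure.pi fun _ => multivariateGaussian 0 S

/-- The sample covariance matrix `(1/k) ∑ Y_l Y_lᵀ` of a sample with known mean zero. -/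
noncomputable def sampleCov {d k : ℕ} (y : Fin k → Vec d) : Mat d :=
  Matrix.of fun i j => (∑ l : Fin k, y l i * y l j) / (k : ℝ)

/-- An estimator of a permutation: a measurable function of the observation. -/
structure Estimator (X : Type) [MeasurableSpace X] (d : ℕ) where
  toFun : X → Equiv.Perm (Fin d)
  measurable : ∀ π : Equiv.Perm (Fin d), MeasurableSet (toFun ⁻¹' {π})

/-- The loss `‖Σ^ρ - Σ^π‖_F²` of the guess `ρ` for the true permutation `π`. -/
noncomputable def loss {d : ℕ} (S : Mat d) (π ρ : Equiv.Perm (Fin d)) : ℝ≥0∞ :=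
  ENNReal.ofReal (frobNorm (permute ρ S - permute π S) ^ 2)

/-- `Q` is an admissible law for the covariance estimate that the oracle returns when the
covariance is `S`: almost surely the estimate is within `√(d/m)` of `S` in operator norm. -/
def IsOracle {d : ℕ} (m : ℕ) (S : Mat d) (Q : ProbabilityMeasure (Mat d)) : Prop :=
  ∀ᵐ T ∂(Q : Measure (Mat d)), opNorm (T - S) ≤ Real.sqrt ((d : ℝ) / (m : ℝ))

/-- Observation in the oracle model: the sample `Y^n` and the oracle's covariance estimate. -/
abbrev OracleObs (d n : ℕ) : Type := (Fin n → Vec d) × Mat d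

/-- The worst-case risk of an estimator in the oracle model, over all permutations, covariance
matrices and admissible oracles. The oracle's output is independent of the sample `Y^n`. -/
noncomputable def oracleRisk {d : ℕ} (m n : ℕ) (e : Estimator (OracleObs d n) d) : ℝ≥0∞ :=
  ⨆ (π : Equiv.Perm (Fin d)) (S : Mat d) (_ : S ∈ covSet d)
    (Q : ProbabilityMeasure (Mat d)) (_ : IsOracle m S Q),
    ∫⁻ z, loss S π (e.toFun z) ∂((sampleLaw n (permute π S)).prod (Q : Measure (Mat d)))

/-- The minimax risk in the oracle model. -/
noncomputable def oracleMinimax (d m n : ℕ) : ℝ≥0∞ :=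
  ⨅ e : Estimator (OracleObs d n) d, oracleRisk m n e

/-- `e` is a Gromov–Wasserstein estimator with the oracle's output `T` as the first covariance
estimate: it maximizes `⟨T^π, Σ̂_Y⟩` over all permutations `π`. -/
def IsGW {d n : ℕ} (e : Estimator (OracleObs d n) d) : Prop :=
  ∀ (y : Fin n → Vec d) (T : Mat d) (π : Equiv.Perm (Fin d)),
    frobInner (permute π T) (sampleCov y) ≤ frobInner (permute (e.toFun (y, T)) T) (sampleCov y)

/-- Observation in the original model: the two samples `X^m` and `Y^n`. -/
abbrev SampleObs (d m n : ℕ) : Type := (Fin m → Vec d) × (Fin n → Vec d)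

/-- The minimax risk in the original covariance alignment model, with independent samples
`X^m` from `N(0, Σ)` and `Y^n` from `N(0, Σ^π)`. -/
noncomputable def originalMinimax (d m n : ℕ) : ℝ≥0∞ :=
  ⨅ e : Estimator (SampleObs d m n) d,
    ⨆ (π : Equiv.Perm (Fin d)) (S : Mat d) (_ : S ∈ covSet d),
      ∫⁻ z, loss S π (e.toFun z) ∂((sampleLaw m S).prod (sampleLaw n (permute π S)))

/-- The rate `d log d / n + d² / m`. -/
noncomputable def oracleRate (d m n : ℕ) : ℝ :=
  (d : ℝ) * Real.log d / n + (d : ℝ) ^ 2 / m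

end CovAlign

namespace CovAlign

/-! Upper bounds. Let `T` be the first covariance estimate, `e = ‖T - S‖_F`, and let `ρ` maximize
`⟨T^ρ, B⟩` with `B` the sample covariance of `Y`. Comparing `ρ` with the true `π` and expanding, `x
= ‖S^ρ - S^π‖_F` satisfies `x²/2 ≤ w x + z (x + 2e)`. Here `z` is the noise `B - S^π` in the
normalized direction `T^ρ - T^π`, and `w` is the error `T - S` in a normalized direction determined
by `S`, `π` and `ρ` (`frobNorm_sq_le_of_alignment`). Given `T` there are at most `d!` directions, so
a Hanson–Wright type exponential moment and a union bound give `E z² ≲ d log d / n`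
(`lintegral_iSup_normDev_sq`). In the oracle model nothing better than `w ≤ e` is used, and `e² ≤ d
‖T - S‖_op² ≤ d²/m`. In the original model `T - S` is itself sampling noise, so `E w² ≲ d log d /
m`; the full error `e` enters only through the product `z e ≤ (s e² + z²/s)/2` with `s` free. A
small `s` makes the `d²/m` term negligible against the oracle rate, which separates the two models.

Lower bounds. For `d²/m`, the oracle may answer with a multiple of the identity that is admissible
both for a diagonal `B` and for its reversal `B^τ`, while the law of `Y` is the same for `(1, B)`
and `(τ, B^τ)`; the two hypotheses cannot be told apart
(`ofReal_frobNorm_permute_sub_le_oracleRisk`). For `d log d / n`, the oracle answers exactly and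
only `Y` is informative: a `χ²` version of Fano's inequality with reference law `N(0, I/2)` is
applied to the permutations of half of the coordinates, for a covariance correlating mirror
coordinates. Most such permutations are far from any given guess. Small `d` is covered by two
hypotheses. -/

variable {d : ℕ}

/-! ### Frobenius and operator norms, and the action of permutations -/

/-- A matrix as a vector of the Euclidean space of its entries. -/
noncomputable def entries (A : Mat d) : EuclideanSpace ℝ (Fin d × Fin d) :=
  WithLp.toLp 2 fun p => A p.1 p.2

lemma frobInner_eq_sum (A B : Mat d) : frobInner A B = ∑ i, ∑ j, A i j * B i j := by
  simp [frobInner, Matrix.trace, Matrix.mul_apply]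

lemma frobInner_eq_inner (A B : Mat d) : frobInner A B = inner ℝ (entries A) (entries B) := by
  rw [frobInner_eq_sum, PiLp.inner_apply, Fintype.sum_prod_type]
  simp [entries, mul_comm]

lemma frobNorm_eq_norm (A : Mat d) : frobNorm A = ‖entries A‖ := by
  rw [frobNorm, frobInner_eq_inner, real_inner_self_eq_norm_sq, Real.sqrt_sq (norm_nonneg _)]

lemma entries_add (A B : Mat d) : entries (A + B) = entries A + entries B := rfl

lemma entries_sub (A B : Mat d) : entries (A - B) = entries A - entries B := rfl

lemma entries_smul (c : ℝ) (A : Mat d) : entries (c • A) = c • entries A := rfl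

lemma frobNorm_nonneg (A : Mat d) : 0 ≤ frobNorm A := Real.sqrt_nonneg _

lemma frobNorm_sq (A : Mat d) : frobNorm A ^ 2 = ∑ i, ∑ j, A i j ^ 2 := by
  rw [frobNorm_eq_norm, ← real_inner_self_eq_norm_sq, ← frobInner_eq_inner, frobInner_eq_sum]
  simp [sq]

lemma frobInner_self (A : Mat d) : frobInner A A = frobNorm A ^ 2 := by
  rw [frobInner_eq_inner, real_inner_self_eq_norm_sq, frobNorm_eq_norm]

lemma abs_frobInner_le (A B : Mat d) : |frobInner A B| ≤ frobNorm A * frobNorm B := by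
  rw [frobInner_eq_inner, frobNorm_eq_norm, frobNorm_eq_norm]
  exact abs_real_inner_le_norm _ _

lemma frobNorm_add_le (A B : Mat d) : frobNorm (A + B) ≤ frobNorm A + frobNorm B := by
  simp only [frobNorm_eq_norm, entries_add]; exact norm_add_le _ _

lemma frobNorm_sub_le (A B : Mat d) : frobNorm (A - B) ≤ frobNorm A + frobNorm B := by
  simp only [frobNorm_eq_norm, entries_sub]; exact norm_sub_le _ _

lemma frobNorm_sub_comm (A B : Mat d) : frobNorm (A - B) = frobNorm (B - A) := by
  simp only [frobNorm_eq_norm, entries_sub]; exact norm_sub_rev _ _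

lemma frobNorm_sub_le_sub_add_sub (A B C : Mat d) :
    frobNorm (A - C) ≤ frobNorm (A - B) + frobNorm (B - C) := by
  simp only [frobNorm_eq_norm, entries_sub]; exact norm_sub_le_norm_sub_add_norm_sub _ _ _

lemma frobNorm_smul (c : ℝ) (A : Mat d) : frobNorm (c • A) = |c| * frobNorm A := by
  simp only [frobNorm_eq_norm, entries_smul, norm_smul, Real.norm_eq_abs]

lemma frobInner_sub_left (A B C : Mat d) :
    frobInner (A - B) C = frobInner A C - frobInner B C := by
  simp only [frobInner_eq_inner, entries_sub, inner_sub_left]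

lemma frobInner_sub_right (A B C : Mat d) :
    frobInner A (B - C) = frobInner A B - frobInner A C := by
  simp only [frobInner_eq_inner, entries_sub, inner_sub_right]

lemma frobInner_comm (A B : Mat d) : frobInner A B = frobInner B A := by
  simp only [frobInner_eq_inner, real_inner_comm]

@[simp] lemma permute_apply (π : Equiv.Perm (Fin d)) (A : Mat d) (i j : Fin d) :
    permute π A i j = A (π i) (π j) := rfl

lemma permute_eq_submatrix (π : Equiv.Perm (Fin d)) (A : Mat d) :
    permute π A = A.submatrix π π := rfl

lemma permute_sub (π : Equiv.Perm (Fin d)) (A B : Mat d) :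
    permute π (A - B) = permute π A - permute π B := rfl

@[simp] lemma permute_one (A : Mat d) : permute 1 A = A := rfl

lemma permute_permute (π τ : Equiv.Perm (Fin d)) (A : Mat d) :
    permute π (permute τ A) = permute (τ * π) A := rfl

lemma frobInner_permute (π : Equiv.Perm (Fin d)) (A B : Mat d) :
    frobInner (permute π A) (permute π B) = frobInner A B := by
  simp only [frobInner_eq_sum, permute_apply]
  rw [← Equiv.sum_comp π (fun i => ∑ j, A i j * B i j)]
  exact Finset.sum_congr rfl fun i _ => Equiv.sum_comp π (fun j => A (π i) j * B (π i) j)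

@[simp] lemma frobNorm_permute (π : Equiv.Perm (Fin d)) (A : Mat d) :
    frobNorm (permute π A) = frobNorm A := by
  rw [frobNorm, frobInner_permute, frobNorm]

lemma frobInner_permute_left (π : Equiv.Perm (Fin d)) (A B : Mat d) :
    frobInner (permute π A) B = frobInner A (permute π⁻¹ B) := by
  rw [← frobInner_permute π A, permute_permute, inv_mul_cancel, permute_one]

lemma frobNorm_transpose (A : Mat d) : frobNorm A.transpose = frobNorm A := by
  rw [← sq_eq_sq₀ (frobNorm_nonneg _) (frobNorm_nonneg _), frobNorm_sq, frobNorm_sq,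
    Finset.sum_comm]
  rfl

lemma norm_mulVec_le (A : Mat d) (x : Fin d → ℝ) :
    ‖WithLp.toLp 2 (A.mulVec x)‖ ≤ opNorm A * ‖(WithLp.toLp 2 x : Vec d)‖ := by
  rw [← Matrix.toEuclideanCLM_toLp (𝕜 := ℝ)]
  exact ContinuousLinearMap.le_opNorm _ _

lemma opNorm_nonneg (A : Mat d) : 0 ≤ opNorm A := norm_nonneg _

lemma frobNorm_sq_eq_sum_col (A : Mat d) :
    frobNorm A ^ 2 = ∑ j, ‖(WithLp.toLp 2 (fun i => A i j) : Vec d)‖ ^ 2 := by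
  rw [frobNorm_sq, Finset.sum_comm]
  simp [EuclideanSpace.real_norm_sq_eq]

lemma frobNorm_mul_le (A B : Mat d) : frobNorm (A * B) ≤ opNorm A * frobNorm B := by
  rw [← sq_le_sq₀ (frobNorm_nonneg _) (mul_nonneg (opNorm_nonneg _) (frobNorm_nonneg _)), mul_pow,
    frobNorm_sq_eq_sum_col, frobNorm_sq_eq_sum_col, Finset.mul_sum]
  refine Finset.sum_le_sum fun j _ => ?_
  rw [← mul_pow]
  exact pow_le_pow_left₀ (norm_nonneg _) (norm_mulVec_le A fun i => B i j) 2

lemma frobNorm_one_sq : frobNorm (1 : Mat d) ^ 2 = d := by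
  rw [frobNorm_sq]
  simp [Matrix.one_apply]

lemma frobNorm_sq_le (A : Mat d) : frobNorm A ^ 2 ≤ d * opNorm A ^ 2 := by
  have h := frobNorm_mul_le A 1
  rw [mul_one] at h
  calc frobNorm A ^ 2 ≤ (opNorm A * frobNorm (1 : Mat d)) ^ 2 :=
        pow_le_pow_left₀ (frobNorm_nonneg _) h 2
    _ = _ := by rw [mul_pow, frobNorm_one_sq, mul_comm]

lemma opNorm_le_frobNorm (A : Mat d) : opNorm A ≤ frobNorm A := by
  refine ContinuousLinearMap.opNorm_le_bound _ (frobNorm_nonneg _) fun x => ?_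
  obtain ⟨x, rfl⟩ : ∃ z : Fin d → ℝ, WithLp.toLp 2 z = x := WithLp.toLp_surjective 2 x
  rw [Matrix.toEuclideanCLM_toLp, ← sq_le_sq₀ (norm_nonneg _)
    (mul_nonneg (frobNorm_nonneg _) (norm_nonneg _)), mul_pow, frobNorm_sq,
    EuclideanSpace.real_norm_sq_eq, EuclideanSpace.real_norm_sq_eq, Finset.sum_mul]
  exact Finset.sum_le_sum fun i _ => Finset.sum_mul_sq_le_sq_mul_sq Finset.univ (A i) x

lemma opNorm_add_le (A B : Mat d) : opNorm (A + B) ≤ opNorm A + opNorm B := by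
  simp only [opNorm, map_add]; exact norm_add_le _ _

lemma opNorm_diagonal_le {v : Fin d → ℝ} {c : ℝ} (hc : 0 ≤ c) (hv : ∀ i, |v i| ≤ c) :
    opNorm (Matrix.diagonal v) ≤ c := by
  refine ContinuousLinearMap.opNorm_le_bound _ hc fun x => ?_
  obtain ⟨x, rfl⟩ : ∃ z : Fin d → ℝ, WithLp.toLp 2 z = x := WithLp.toLp_surjective 2 x
  rw [Matrix.toEuclideanCLM_toLp, ← sq_le_sq₀ (norm_nonneg _) (mul_nonneg hc (norm_nonneg _)),
    mul_pow, EuclideanSpace.real_norm_sq_eq, EuclideanSpace.real_norm_sq_eq, Finset.mul_sum]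
  refine Finset.sum_le_sum fun i _ => ?_
  simp only [Matrix.mulVec_diagonal, mul_pow]
  exact mul_le_mul_of_nonneg_right (sq_le_sq' (abs_le.1 (hv i)).1 (abs_le.1 (hv i)).2) (sq_nonneg _)

lemma opNorm_permute (π : Equiv.Perm (Fin d)) (A : Mat d) : opNorm (permute π A) ≤ opNorm A := by
  refine ContinuousLinearMap.opNorm_le_bound _ (opNorm_nonneg _) fun x => ?_
  obtain ⟨x, rfl⟩ : ∃ z : Fin d → ℝ, WithLp.toLp 2 z = x := WithLp.toLp_surjective 2 x
  have h := norm_mulVec_le A (x ∘ π.symm)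
  have h1 : ‖(WithLp.toLp 2 (x ∘ π.symm) : Vec d)‖ = ‖(WithLp.toLp 2 x : Vec d)‖ := by
    rw [← sq_eq_sq₀ (norm_nonneg _) (norm_nonneg _), EuclideanSpace.real_norm_sq_eq,
      EuclideanSpace.real_norm_sq_eq]
    exact Equiv.sum_comp π.symm (fun i => x i ^ 2)
  have h2 : ‖(WithLp.toLp 2 (A.mulVec (x ∘ π.symm)) : Vec d)‖
      = ‖(WithLp.toLp 2 ((permute π A).mulVec x) : Vec d)‖ := by
    rw [← sq_eq_sq₀ (norm_nonneg _) (norm_nonneg _), EuclideanSpace.real_norm_sq_eq,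
      EuclideanSpace.real_norm_sq_eq, ← Equiv.sum_comp π]
    refine Finset.sum_congr rfl fun i _ => ?_
    congr 1
    simp only [Matrix.mulVec, dotProduct, permute_apply]
    rw [← Equiv.sum_comp π]
    simp only [Function.comp_apply, Equiv.symm_apply_apply]
  rw [Matrix.toEuclideanCLM_toLp]
  rwa [h1, h2] at h

lemma permute_mem_covSet (π : Equiv.Perm (Fin d)) {S : Mat d} (hS : S ∈ covSet d) :
    permute π S ∈ covSet d :=
  ⟨hS.1.submatrix π.injective, (opNorm_permute π S).trans hS.2⟩

/-! ### Scalar Gaussian integrals -/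

lemma exp_neg_add_sq_le {u : ℝ} (hu : |u| ≤ 1 / 2) : Real.exp (-(u + u ^ 2)) ≤ 1 - u := by
  obtain ⟨h1, h2⟩ := abs_le.1 hu
  rw [Real.exp_neg, inv_le_comm₀ (Real.exp_pos _) (by linarith), inv_eq_one_div,
    div_le_iff₀ (by linarith)]
  rcases le_total 0 u with h0 | h0
  -- Since `(1 + u + u²)(1 - u) = 1 - u³`, the linear lower bound on the exponential is enough only
  -- for `u ≤ 0`; for `u ≥ 0` the quadratic term is needed.
  · have h := Real.quadratic_le_exp_of_nonneg (x := u + u ^ 2) (by positivity)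
    refine le_trans ?_ (mul_le_mul_of_nonneg_right h (by linarith))
    nlinarith [mul_nonneg (mul_nonneg h0 h0) (by linarith : 0 ≤ 1 / 2 - u),
      mul_nonneg (mul_nonneg (mul_nonneg h0 h0) h0) (by linarith : 0 ≤ 1 / 2 - u),
      mul_nonneg (mul_nonneg (mul_nonneg (mul_nonneg h0 h0) h0) h0) (by linarith : 0 ≤ 1 / 2 - u),
      pow_nonneg h0 2, pow_nonneg h0 3, pow_nonneg h0 4]
  · have h := Real.add_one_le_exp (u + u ^ 2)
    refine le_trans ?_ (mul_le_mul_of_nonneg_right h (by linarith))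
    nlinarith [mul_nonneg (sq_nonneg u) (neg_nonneg.2 h0)]

lemma inv_sqrt_one_sub_le {u : ℝ} (hu : |u| ≤ 1 / 2) :
    1 / √(1 - u) ≤ Real.exp ((u + u ^ 2) / 2) := by
  obtain ⟨h1, h2⟩ := abs_le.1 hu
  have h := Real.sqrt_le_sqrt (exp_neg_add_sq_le hu)
  rw [← Real.exp_half] at h
  rw [div_le_iff₀ (Real.sqrt_pos.2 (by linarith))]
  calc (1 : ℝ) = Real.exp ((u + u ^ 2) / 2) * Real.exp (-(u + u ^ 2) / 2) := by
        rw [← Real.exp_add]; ring_nf; simp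
    _ ≤ _ := mul_le_mul_of_nonneg_left h (Real.exp_pos _).le

lemma lintegral_exp_neg_mul_sq {b : ℝ} (hb : 0 < b) :
    ∫⁻ x : ℝ, ENNReal.ofReal (Real.exp (-b * x ^ 2)) = ENNReal.ofReal √(Real.pi / b) := by
  rw [← ofReal_integral_eq_lintegral_ofReal (integrable_exp_neg_mul_sq hb)
    (Filter.Eventually.of_forall fun x => (Real.exp_pos _).le), integral_gaussian]

/-- The integral equals `exp(-s) / √(1 - 2s)`, and `-log(1 - u) ≤ u + u²` at `u = 2s` cancels the
linear term. -/
lemma lintegral_exp_sq_gaussianReal_one {s : ℝ} (hs : |s| ≤ 1 / 4) :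
    ∫⁻ x, ENNReal.ofReal (Real.exp (s * (x ^ 2 - 1))) ∂(gaussianReal 0 1)
      ≤ ENNReal.ofReal (Real.exp (2 * s ^ 2)) := by
  obtain ⟨h1, h2⟩ := abs_le.1 hs
  have hb : 0 < 1 / 2 - s := by linarith
  rw [gaussianReal_of_var_ne_zero _ one_ne_zero,
    lintegral_withDensity_eq_lintegral_mul _ (measurable_gaussianPDF _ _) (by fun_prop)]
  have h : ∀ x : ℝ, (gaussianPDF 0 1 * fun x => ENNReal.ofReal (Real.exp (s * (x ^ 2 - 1)))) x
      = ENNReal.ofReal ((√(2 * Real.pi))⁻¹ * Real.exp (-s))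
        * ENNReal.ofReal (Real.exp (-(1 / 2 - s) * x ^ 2)) := by
    intro x
    rw [Pi.mul_apply, gaussianPDF, gaussianPDFReal, ← ENNReal.ofReal_mul (by positivity),
      ← ENNReal.ofReal_mul (by positivity)]
    congr 1
    rw [mul_assoc, mul_assoc (√(2 * Real.pi))⁻¹, ← Real.exp_add, ← Real.exp_add]
    simp only [NNReal.coe_one, mul_one, sub_zero]
    ring_nf
  simp_rw [h]
  rw [lintegral_const_mul _ (by fun_prop), lintegral_exp_neg_mul_sq hb,
    ← ENNReal.ofReal_mul (by positivity)]
  refine ENNReal.ofReal_le_ofReal ?_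
  have h3 := inv_sqrt_one_sub_le (u := 2 * s) (by rw [abs_mul]; norm_num; linarith)
  have h4 : Real.pi / (1 / 2 - s) = 2 * Real.pi / (1 - 2 * s) := by
    field_simp
  rw [h4, Real.sqrt_div (by positivity)]
  have h5 : √(2 * Real.pi) ≠ 0 := (Real.sqrt_pos.2 (by positivity)).ne'
  calc (√(2 * Real.pi))⁻¹ * Real.exp (-s) * (√(2 * Real.pi) / √(1 - 2 * s))
      = Real.exp (-s) * (1 / √(1 - 2 * s)) := by field_simp
    _ ≤ Real.exp (-s) * Real.exp ((2 * s + (2 * s) ^ 2) / 2) :=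
        mul_le_mul_of_nonneg_left h3 (Real.exp_pos _).le
    _ = _ := by rw [← Real.exp_add]; ring_nf

lemma lintegral_pi_prod {X : Type} [MeasurableSpace X] : ∀ {n : ℕ} (μ : Fin n → Measure X)
    [∀ i, IsProbabilityMeasure (μ i)] {f : Fin n → X → ℝ≥0∞} (_ : ∀ i, Measurable (f i)),
    ∫⁻ x, ∏ i, f i (x i) ∂(Measure.pi μ) = ∏ i, ∫⁻ x, f i x ∂(μ i)
  | 0, μ, _, f, hf => by simp
  | n + 1, μ, _, f, hf => by
    rw [← ((measurePreserving_piFinSuccAbove μ 0).symm _).lintegral_comp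
      (f := fun x => ∏ i, f i (x i))
      (Finset.measurable_fun_prod _ fun i _ => (hf i).comp (measurable_pi_apply i))]
    simp_rw [MeasurableEquiv.piFinSuccAbove_symm_apply, Fin.insertNthEquiv,
      Fin.prod_univ_succ, Fin.insertNth_zero, Equiv.coe_fn_mk, Fin.cons_succ,
      Fin.zero_succAbove, cast_eq, Fin.cons_zero]
    rw [lintegral_prod_mul (f := f 0) (g := fun y : Fin n → X => ∏ i, f i.succ (y i))
      (hf 0).aemeasurable (Finset.measurable_fun_prod _ fun i _ =>
        (hf i.succ).comp (measurable_pi_apply i)).aemeasurable,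
      lintegral_pi_prod (fun i => μ i.succ) fun i => hf i.succ]

/-! ### The `χ²`-relation between measures -/

/-- The relation `∫ (dP/dQ)² dQ ≤ κ`, phrased by duality. -/
def ChiSqLe {X : Type} [MeasurableSpace X] (κ : ℝ≥0∞) (P Q : Measure X) : Prop :=
  ∀ f : X → ℝ≥0∞, Measurable f → (∫⁻ x, f x ∂P) ^ 2 ≤ κ * ∫⁻ x, f x ^ 2 ∂Q

namespace ChiSqLe

variable {X Y : Type} [MeasurableSpace X] [MeasurableSpace Y]

lemma mono {κ κ' : ℝ≥0∞} {P Q : Measure X} (h : ChiSqLe κ P Q) (hκ : κ ≤ κ') :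
    ChiSqLe κ' P Q :=
  fun f hf => (h f hf).trans (mul_le_mul_left hκ _)

lemma map {κ : ℝ≥0∞} {P Q : Measure X} (h : ChiSqLe κ P Q) {φ : X → Y} (hφ : Measurable φ) :
    ChiSqLe κ (P.map φ) (Q.map φ) := by
  intro f hf
  rw [lintegral_map hf hφ, lintegral_map (hf.pow_const 2) hφ]
  exact h _ (hf.comp hφ)

/-- The dual form tensorizes by Fubini: one inequality bounds the square of the outer integral, the
other the square of each inner integral. No densities are involved. -/
lemma prod {κ κ' : ℝ≥0∞} {P Q : Measure X} {P' Q' : Measure Y} [SFinite P'] [SFinite Q']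
    (h : ChiSqLe κ P Q) (h' : ChiSqLe κ' P' Q') :
    ChiSqLe (κ * κ') (P.prod P') (Q.prod Q') := by
  intro f hf
  rw [lintegral_prod _ hf.aemeasurable, lintegral_prod _ (hf.pow_const 2).aemeasurable]
  refine (h _ hf.lintegral_prod_right').trans ?_
  rw [mul_assoc, ← lintegral_const_mul _ (hf.pow_const 2).lintegral_prod_right']
  gcongr with x
  exact h' _ (hf.comp measurable_prodMk_left)

lemma pi : ∀ {n : ℕ} {κ : Fin n → ℝ≥0∞} {P Q : Fin n → Measure X}
    [∀ i, IsProbabilityMeasure (P i)] [∀ i, IsProbabilityMeasure (Q i)]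
    (_ : ∀ i, ChiSqLe (κ i) (P i) (Q i)), ChiSqLe (∏ i, κ i) (Measure.pi P) (Measure.pi Q)
  | 0, κ, P, Q, _, _, _ => by
    intro f hf
    rw [Measure.pi_of_empty P finZeroElim, Measure.pi_of_empty Q finZeroElim,
      lintegral_dirac' _ hf, lintegral_dirac' _ (hf.pow_const 2)]
    simp
  | n + 1, κ, P, Q, _, _, h => by
    have h1 := (h 0).prod (ChiSqLe.pi fun i : Fin n => h i.succ)
    rw [← Fin.prod_univ_succ] at h1
    have h2 := h1.map (MeasurableEquiv.piFinSuccAbove (fun _ : Fin (n + 1) => X) 0).symm.measurable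
    have hP := ((measurePreserving_piFinSuccAbove P 0).symm _).map_eq
    have hQ := ((measurePreserving_piFinSuccAbove Q 0).symm _).map_eq
    simp only [Fin.zero_succAbove] at hP hQ
    rwa [hP, hQ] at h2

end ChiSqLe

/-- Cauchy–Schwarz for `∫ (a f) h`. The factorization `p = a h`, `q = a²` makes `∫ h²` the usual `∫
p²/q` without a division in `ℝ≥0∞`. -/
lemma chiSqLe_of_pdf {p q a h : ℝ → ℝ≥0∞} (hp : Measurable p) (hq : Measurable q)
    (ha : Measurable a) (hh : Measurable h) (hpa : ∀ x, p x = a x * h x)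
    (hqa : ∀ x, q x = a x ^ 2) :
    ChiSqLe (∫⁻ x, h x ^ 2) (volume.withDensity p) (volume.withDensity q) := by
  intro f hf
  rw [lintegral_withDensity_eq_lintegral_mul _ hp hf,
    lintegral_withDensity_eq_lintegral_mul _ hq (hf.pow_const 2)]
  have key := ENNReal.lintegral_mul_le_Lp_mul_Lq (volume : Measure ℝ) Real.HolderConjugate.two_two
    (ha.mul hf).aemeasurable hh.aemeasurable
  have e1 : ∀ x, (p * f) x = ((a * f) * h) x := fun x => by
    simp only [Pi.mul_apply, hpa]; ring
  have e2 : ∀ x, (q * fun x => f x ^ 2) x = (a * f) x ^ 2 := fun x => by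
    simp only [Pi.mul_apply, hqa]; ring
  simp_rw [e1, e2]
  calc _ ≤ _ := pow_le_pow_left' key 2
    _ = _ := by
      rw [mul_pow, ← ENNReal.rpow_mul_natCast, ← ENNReal.rpow_mul_natCast, mul_comm]
      norm_num

/-- For variances `(1 + t)/2` and `1/2` the integral `∫ p²/q` is exactly `1 / √(1 - t²)`; the
first-order term in `t` is absent. -/
lemma chiSqLe_gaussianReal {t : ℝ} (ht : t ^ 2 ≤ 1 / 4) :
    ChiSqLe (ENNReal.ofReal (Real.exp (t ^ 2))) (gaussianReal 0 ((1 + t) / 2).toNNReal)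
      (gaussianReal 0 (1 / 2)) := by
  have ht' : |t| ≤ 1 / 2 := abs_le_of_sq_le_sq (by linarith) (by norm_num)
  obtain ⟨h1, h2⟩ := abs_le.1 ht'
  have hv : ((1 + t) / 2).toNNReal ≠ 0 := (Real.toNNReal_pos.2 (by linarith)).ne'
  have hw : (1 / 2 : NNReal) ≠ 0 := by norm_num
  rw [gaussianReal_of_var_ne_zero _ hv, gaussianReal_of_var_ne_zero _ hw]
  have hpi := Real.pi_pos
  set c : ℝ := √(√Real.pi)⁻¹ with hc
  have hc0 : 0 < c := Real.sqrt_pos.2 (inv_pos.2 (Real.sqrt_pos.2 hpi))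
  have hc2 : c ^ 2 = (√Real.pi)⁻¹ := Real.sq_sqrt (inv_nonneg.2 (Real.sqrt_nonneg _))
  have ht1 : 0 < 1 + t := by linarith
  have ht2 : 0 < 1 - t := by linarith
  refine (chiSqLe_of_pdf (measurable_gaussianPDF _ _) (measurable_gaussianPDF _ _)
    (a := fun x => ENNReal.ofReal (c * Real.exp (-x ^ 2 / 2)))
    (h := fun x => ENNReal.ofReal (c * (√(1 + t))⁻¹ * Real.exp (-x ^ 2 / (1 + t) + x ^ 2 / 2)))
    (by fun_prop) (by fun_prop) ?_ ?_).mono ?_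
  · intro x
    rw [gaussianPDF, gaussianPDFReal, ← ENNReal.ofReal_mul (by positivity),
      Real.coe_toNNReal _ (by linarith)]
    congr 1
    have e : 2 * Real.pi * ((1 + t) / 2) = Real.pi * (1 + t) := by ring
    rw [e, Real.sqrt_mul hpi.le, mul_inv, ← hc2]
    calc _ = c ^ 2 * (√(1 + t))⁻¹ * Real.exp (-x ^ 2 / 2 + (-x ^ 2 / (1 + t) + x ^ 2 / 2)) := by
          congr 2; field_simp; ring
      _ = _ := by rw [Real.exp_add]; ring
  · intro x
    rw [gaussianPDF, gaussianPDFReal, ← ENNReal.ofReal_pow (by positivity)]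
    congr 1
    have e : 2 * Real.pi * ((1 / 2 : NNReal) : ℝ) = Real.pi := by push_cast; ring
    rw [e, mul_pow, hc2, ← Real.exp_nat_mul]
    congr 2
    push_cast; ring
  · have e : ∀ x : ℝ, ENNReal.ofReal (c * (√(1 + t))⁻¹ *
        Real.exp (-x ^ 2 / (1 + t) + x ^ 2 / 2)) ^ 2
        = ENNReal.ofReal ((√Real.pi)⁻¹ * (1 + t)⁻¹) *
          ENNReal.ofReal (Real.exp (-((1 - t) / (1 + t)) * x ^ 2)) := by
      intro x
      rw [← ENNReal.ofReal_pow (by positivity), ← ENNReal.ofReal_mul (by positivity)]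
      congr 1
      rw [mul_pow, mul_pow, hc2, inv_pow, Real.sq_sqrt ht1.le, ← Real.exp_nat_mul]
      congr 2
      push_cast
      field_simp
      ring
    simp_rw [e]
    rw [lintegral_const_mul _ (by fun_prop), lintegral_exp_neg_mul_sq (by positivity),
      ← ENNReal.ofReal_mul (by positivity)]
    refine ENNReal.ofReal_le_ofReal ?_
    have h3 := inv_sqrt_one_sub_le (u := t ^ 2) (by rw [abs_of_nonneg (sq_nonneg t)]; linarith)
    have e2 : (√Real.pi)⁻¹ * (1 + t)⁻¹ * √(Real.pi / ((1 - t) / (1 + t))) = 1 / √(1 - t ^ 2) := by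
      have e3 : Real.pi / ((1 - t) / (1 + t)) = Real.pi * ((1 + t) ^ 2 / (1 - t ^ 2)) := by
        have : 1 - t ^ 2 = (1 - t) * (1 + t) := by ring
        rw [this]; field_simp
      rw [e3, Real.sqrt_mul hpi.le, Real.sqrt_div (sq_nonneg _), Real.sqrt_sq ht1.le]
      have := (Real.sqrt_pos.2 hpi).ne'
      field_simp
    rw [e2]
    refine h3.trans (Real.exp_le_exp.2 ?_)
    nlinarith [sq_nonneg t]

/-! ### Exponential moments of Gaussian quadratic forms -/

open scoped MatrixOrder in
lemma exists_sqrt_multivariateGaussian {S : Mat d} (hS : S.PosSemidef) :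
    ∃ A : Mat d, A.IsHermitian ∧ A * A = S ∧
      multivariateGaussian 0 S = (stdGaussian (Vec d)).map (Matrix.toEuclideanCLM (𝕜 := ℝ) A) := by
  refine ⟨CFC.sqrt S, (Matrix.nonneg_iff_posSemidef.1 (CFC.sqrt_nonneg S)).1,
    CFC.sqrt_mul_sqrt_self _ hS.nonneg, ?_⟩
  simp [multivariateGaussian]

/-- The quadratic form `yᵀ D y`. -/
noncomputable def quadForm (D : Mat d) (y : Vec d) : ℝ :=
  inner ℝ y (Matrix.toEuclideanCLM (𝕜 := ℝ) D y)

lemma quadForm_eq_sum (D : Mat d) (y : Vec d) : quadForm D y = ∑ i, ∑ j, D i j * (y i * y j) := by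
  rw [quadForm, Matrix.inner_toEuclideanCLM]
  simp only [dotProduct, Matrix.mulVec, Finset.mul_sum]
  exact Finset.sum_congr rfl fun i _ => Finset.sum_congr rfl fun j _ => by ring

lemma inner_toEuclideanCLM_comm {M : Mat d} (hM : M.IsHermitian) (x y : Vec d) :
    inner ℝ x (Matrix.toEuclideanCLM (𝕜 := ℝ) M y)
      = inner ℝ (Matrix.toEuclideanCLM (𝕜 := ℝ) M x) y := by
  have hM' : IsSelfAdjoint M := hM
  have := hM'.map (Matrix.toEuclideanCLM (𝕜 := ℝ) (n := Fin d))
  rw [← ContinuousLinearMap.adjoint_inner_left, this.adjoint_eq]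

lemma toEuclideanCLM_eigenvectorBasis {M : Mat d} (hM : M.IsHermitian) (i : Fin d) :
    Matrix.toEuclideanCLM (𝕜 := ℝ) M (hM.eigenvectorBasis i)
      = hM.eigenvalues i • hM.eigenvectorBasis i := by
  have := hM.mulVec_eigenvectorBasis i
  ext j
  rw [Matrix.ofLp_toEuclideanCLM, this]
  rfl

lemma quadForm_eq_sum_eigenvalues {M : Mat d} (hM : M.IsHermitian) (x : Vec d) :
    quadForm M x = ∑ i, hM.eigenvalues i * inner ℝ (hM.eigenvectorBasis i) x ^ 2 := by
  rw [quadForm, ← hM.eigenvectorBasis.sum_inner_mul_inner]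
  refine Finset.sum_congr rfl fun i _ => ?_
  rw [inner_toEuclideanCLM_comm hM, toEuclideanCLM_eigenvectorBasis, real_inner_smul_left,
    real_inner_comm x]
  ring

lemma sum_norm_sq_orthonormalBasis {M : Mat d} (hM : M.IsHermitian)
    (b : OrthonormalBasis (Fin d) ℝ (Vec d)) :
    ∑ i, ‖Matrix.toEuclideanCLM (𝕜 := ℝ) M (b i)‖ ^ 2 = frobNorm M ^ 2 := by
  set e := EuclideanSpace.basisFun (Fin d) ℝ
  have h2 : ∀ j, ∑ i, inner ℝ (e j) (Matrix.toEuclideanCLM (𝕜 := ℝ) M (b i)) ^ 2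
      = ‖(WithLp.toLp 2 (fun i => M i j) : Vec d)‖ ^ 2 := by
    intro j
    simp_rw [inner_toEuclideanCLM_comm hM]
    rw [b.sum_sq_inner_left]
    congr 2
    ext i
    rw [Matrix.ofLp_toEuclideanCLM]
    simp [e]
  simp_rw [← e.sum_sq_inner_right]
  rw [Finset.sum_comm, frobNorm_sq_eq_sum_col]
  exact Finset.sum_congr rfl fun j _ => h2 j

lemma sum_eigenvalues_sq {M : Mat d} (hM : M.IsHermitian) :
    ∑ i, hM.eigenvalues i ^ 2 = frobNorm M ^ 2 := by
  rw [← sum_norm_sq_orthonormalBasis hM hM.eigenvectorBasis]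
  refine Finset.sum_congr rfl fun i _ => ?_
  rw [toEuclideanCLM_eigenvectorBasis, norm_smul, hM.eigenvectorBasis.norm_eq_one]
  simp

/-- In an eigenbasis of `M` the coordinates remain independent standard Gaussians, so the integral
is a product of scalar ones. The eigenvalues sum to the trace, their squares to `‖M‖_F²`; in
particular each is at most `‖M‖_F` in absolute value, so the scalar condition holds. -/
lemma lintegral_exp_quadForm_stdGaussian {M : Mat d} (hM : M.IsHermitian) {c : ℝ}
    (hc : |c| * frobNorm M ≤ 1 / 4) :
    ∫⁻ x, ENNReal.ofReal (Real.exp (c * (quadForm M x - M.trace))) ∂(stdGaussian (Vec d))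
      ≤ ENNReal.ofReal (Real.exp (2 * c ^ 2 * frobNorm M ^ 2)) := by
  set b := hM.eigenvectorBasis
  have hmeas : Measurable fun x : Vec d => quadForm M x := by
    unfold quadForm; fun_prop
  rw [stdGaussian_eq_map_pi_orthonormalBasis b, lintegral_map (by fun_prop) (by fun_prop)]
  have h1 : ∀ x : Fin d → ℝ, ENNReal.ofReal
      (Real.exp (c * (quadForm M (∑ i, x i • b i) - M.trace)))
      = ∏ i, ENNReal.ofReal (Real.exp (c * hM.eigenvalues i * (x i ^ 2 - 1))) := by
    intro x
    rw [← ENNReal.ofReal_prod_of_nonneg fun i _ => (Real.exp_pos _).le, ← Real.exp_sum,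
      quadForm_eq_sum_eigenvalues hM, hM.trace_eq_sum_eigenvalues]
    congr 2
    simp only [RCLike.ofReal_real_eq_id, id]
    rw [← Finset.sum_sub_distrib, Finset.mul_sum]
    refine Finset.sum_congr rfl fun i _ => ?_
    rw [inner_sum, Finset.sum_eq_single i]
    · rw [real_inner_smul_right, real_inner_self_eq_norm_sq, b.norm_eq_one]
      ring
    · intro j _ hj
      rw [real_inner_smul_right, b.inner_eq_zero hj.symm, mul_zero]
    · simp
  simp_rw [h1]
  rw [lintegral_pi_prod (fun _ : Fin d => gaussianReal 0 1)
    (f := fun i z => ENNReal.ofReal (Real.exp (c * hM.eigenvalues i * (z ^ 2 - 1))))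
    fun i => by fun_prop]
  have h2 : ∀ i, |c * hM.eigenvalues i| ≤ 1 / 4 := by
    intro i
    rw [abs_mul]
    refine le_trans (mul_le_mul_of_nonneg_left ?_ (abs_nonneg c)) hc
    refine abs_le_of_sq_le_sq ?_ (frobNorm_nonneg _)
    rw [← sum_eigenvalues_sq hM]
    exact Finset.single_le_sum (f := fun i => hM.eigenvalues i ^ 2)
      (fun i _ => sq_nonneg _) (Finset.mem_univ i)
  calc _ ≤ ∏ i, ENNReal.ofReal (Real.exp (2 * (c * hM.eigenvalues i) ^ 2)) :=
        Finset.prod_le_prod' fun i _ => lintegral_exp_sq_gaussianReal_one (h2 i)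
    _ = _ := by
        rw [← ENNReal.ofReal_prod_of_nonneg fun i _ => (Real.exp_pos _).le, ← Real.exp_sum,
          ← sum_eigenvalues_sq hM, Finset.mul_sum]
        congr 3
        ext i
        ring

lemma quadForm_transpose (D : Mat d) (y : Vec d) : quadForm D.transpose y = quadForm D y := by
  rw [quadForm_eq_sum, quadForm_eq_sum, Finset.sum_comm]
  exact Finset.sum_congr rfl fun i _ => Finset.sum_congr rfl fun j _ => by
    rw [Matrix.transpose_apply]; ring

lemma opNorm_le_one_of_mul_self {A : Mat d} (hA : A.IsHermitian) (h : opNorm (A * A) ≤ 1) :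
    opNorm A ≤ 1 := by
  refine ContinuousLinearMap.opNorm_le_bound _ zero_le_one fun x => ?_
  rw [one_mul, ← sq_le_sq₀ (norm_nonneg _) (norm_nonneg _), ← real_inner_self_eq_norm_sq,
    ← inner_toEuclideanCLM_comm hA]
  have e : Matrix.toEuclideanCLM (𝕜 := ℝ) A (Matrix.toEuclideanCLM (𝕜 := ℝ) A x)
      = Matrix.toEuclideanCLM (𝕜 := ℝ) (A * A) x := by rw [map_mul]; rfl
  rw [e]
  refine (real_inner_le_norm _ _).trans ?_
  rw [sq]
  refine mul_le_mul_of_nonneg_left ?_ (norm_nonneg _)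
  refine (ContinuousLinearMap.le_opNorm _ _).trans ?_
  exact mul_le_of_le_one_left (norm_nonneg _) h

/-- Writing `y = A x` with `A = √S` and `x` standard replaces `D` by the symmetric part of `A D A`.
Its trace is `⟨D, S⟩`, and its Frobenius norm is at most that of `D` because `‖A‖_op ≤ 1`.
Symmetrizing matters since `D` will involve an arbitrary oracle output. -/
lemma lintegral_exp_quadForm {S : Mat d} (hS : S ∈ covSet d) (D : Mat d) {c : ℝ}
    (hc : |c| * frobNorm D ≤ 1 / 4) :
    ∫⁻ y, ENNReal.ofReal (Real.exp (c * (quadForm D y - frobInner D S)))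
        ∂(multivariateGaussian 0 S)
      ≤ ENNReal.ofReal (Real.exp (2 * c ^ 2 * frobNorm D ^ 2)) := by
  obtain ⟨A, hA, hAS, hmap⟩ := exists_sqrt_multivariateGaussian hS.1.posSemidef
  have hmeas : Measurable fun x : Vec d => quadForm D x := by
    unfold quadForm; fun_prop
  rw [hmap, lintegral_map (by fun_prop) (by fun_prop)]
  have hAt : A.transpose = A := by
    have := hA.eq
    rwa [Matrix.conjTranspose_eq_transpose_of_trivial] at this
  have hA1 : opNorm A ≤ 1 := opNorm_le_one_of_mul_self hA (hAS ▸ hS.2)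
  set N : Mat d := A * D * A with hN
  set M : Mat d := (1 / 2 : ℝ) • (N + N.transpose) with hMdef
  have hM : M.IsHermitian := by
    rw [Matrix.IsHermitian, Matrix.conjTranspose_eq_transpose_of_trivial, hMdef,
      Matrix.transpose_smul, Matrix.transpose_add, Matrix.transpose_transpose, add_comm]
  have hquad : ∀ x, quadForm D (Matrix.toEuclideanCLM (𝕜 := ℝ) A x) = quadForm M x := by
    intro x
    have e1 : quadForm D (Matrix.toEuclideanCLM (𝕜 := ℝ) A x) = quadForm N x := by
      rw [quadForm, ← inner_toEuclideanCLM_comm hA, quadForm, hN, map_mul, map_mul]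
      rfl
    have e2 : quadForm M x = (1 / 2) * (quadForm N x + quadForm N.transpose x) := by
      simp only [quadForm, hMdef, map_smul, map_add, smul_apply,
        add_apply, inner_smul_right, inner_add_right]
    rw [e1, e2, quadForm_transpose]; ring
  have htr : M.trace = frobInner D S := by
    have hSt : S.transpose = S := by
      have := hS.1.1.eq
      rwa [Matrix.conjTranspose_eq_transpose_of_trivial] at this
    rw [hMdef, Matrix.trace_smul, Matrix.trace_add, Matrix.trace_transpose, frobInner, hSt, hN,
      Matrix.trace_mul_comm, ← mul_assoc, hAS, Matrix.trace_mul_comm, smul_eq_mul]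
    ring
  have hnorm : frobNorm M ≤ frobNorm D := by
    have e1 : frobNorm N ≤ frobNorm D := by
      rw [hN, mul_assoc]
      refine (frobNorm_mul_le _ _).trans ((mul_le_of_le_one_left (frobNorm_nonneg _) hA1).trans ?_)
      rw [← frobNorm_transpose, Matrix.transpose_mul, hAt]
      refine (frobNorm_mul_le _ _).trans ((mul_le_of_le_one_left (frobNorm_nonneg _) hA1).trans ?_)
      rw [frobNorm_transpose]
    have e2 := frobNorm_add_le N N.transpose
    rw [frobNorm_transpose] at e2
    rw [hMdef, frobNorm_smul]
    norm_num
    linarith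
  simp_rw [hquad, ← htr]
  refine (lintegral_exp_quadForm_stdGaussian hM
    ((mul_le_mul_of_nonneg_left hnorm (abs_nonneg c)).trans hc)).trans ?_
  refine ENNReal.ofReal_le_ofReal (Real.exp_le_exp.2 ?_)
  exact mul_le_mul_of_nonneg_left (pow_le_pow_left₀ (frobNorm_nonneg _) hnorm 2) (by positivity)

lemma frobInner_sampleCov_sub {k : ℕ} (hk : 0 < k) (D S : Mat d) (y : Fin k → Vec d) :
    frobInner D (sampleCov y - S) = (∑ l, (quadForm D (y l) - frobInner D S)) / k := by
  have hk' : (k : ℝ) ≠ 0 := by positivity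
  rw [frobInner_sub_right, Finset.sum_sub_distrib, sub_div]
  congr 1
  · rw [frobInner_eq_sum]
    simp_rw [quadForm_eq_sum, sampleCov, Matrix.of_apply]
    conv_rhs => rw [Finset.sum_comm, Finset.sum_div]
    refine Finset.sum_congr rfl fun i _ => ?_
    conv_rhs => rw [Finset.sum_comm, Finset.sum_div]
    refine Finset.sum_congr rfl fun j _ => ?_
    rw [← Finset.mul_sum, mul_div_assoc]
  · simp only [Finset.sum_const, Finset.card_univ, Fintype.card_fin, nsmul_eq_mul]
    field_simp

instance {k : ℕ} (S : Mat d) : IsProbabilityMeasure (sampleLaw k S) := by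
  unfold sampleLaw; infer_instance

lemma lintegral_exp_frobInner_sampleCov {k : ℕ} (hk : 0 < k) {S : Mat d} (hS : S ∈ covSet d)
    (D : Mat d) {c : ℝ} (hc : |c| * frobNorm D ≤ k / 4) :
    ∫⁻ y, ENNReal.ofReal (Real.exp (c * frobInner D (sampleCov y - S))) ∂(sampleLaw k S)
      ≤ ENNReal.ofReal (Real.exp (2 * c ^ 2 * frobNorm D ^ 2 / k)) := by
  have hk' : (0 : ℝ) < k := by positivity
  have h1 : ∀ y : Fin k → Vec d, ENNReal.ofReal (Real.exp (c * frobInner D (sampleCov y - S)))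
      = ∏ l, ENNReal.ofReal (Real.exp (c / k * (quadForm D (y l) - frobInner D S))) := by
    intro y
    rw [← ENNReal.ofReal_prod_of_nonneg fun i _ => (Real.exp_pos _).le, ← Real.exp_sum,
      frobInner_sampleCov_sub hk, ← Finset.mul_sum]
    congr 2
    ring
  have hmeas : Measurable fun x : Vec d => quadForm D x := by
    unfold quadForm; fun_prop
  simp_rw [h1]
  rw [sampleLaw, lintegral_pi_prod (fun _ : Fin k => multivariateGaussian 0 S)
    (f := fun _ z => ENNReal.ofReal (Real.exp (c / k * (quadForm D z - frobInner D S))))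
    fun i => by fun_prop]
  have hck : |c / k| * frobNorm D ≤ 1 / 4 := by
    rw [abs_div, abs_of_pos hk', div_mul_eq_mul_div, div_le_iff₀ hk']
    linarith
  calc _ ≤ ∏ _l : Fin k, ENNReal.ofReal (Real.exp (2 * (c / k) ^ 2 * frobNorm D ^ 2)) :=
        Finset.prod_le_prod' fun i _ => lintegral_exp_quadForm hS D hck
    _ = _ := by
        rw [← ENNReal.ofReal_prod_of_nonneg fun i _ => (Real.exp_pos _).le, ← Real.exp_sum,
          Finset.sum_const, Finset.card_univ, Fintype.card_fin, nsmul_eq_mul]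
        congr 2
        field_simp

/-! ### Deviations of the sample covariance, uniformly over finitely many directions -/

/-- The sampling error of the sample covariance in the direction of the matrix `D`. -/
noncomputable def normDev {k : ℕ} (D S : Mat d) (y : Fin k → Vec d) : ℝ :=
  frobInner D (sampleCov y - S) / frobNorm D

lemma measurable_frobInner {X : Type*} [MeasurableSpace X] {f g : X → Mat d}
    (hf : ∀ i j, Measurable fun x => f x i j) (hg : ∀ i j, Measurable fun x => g x i j) :
    Measurable fun x => frobInner (f x) (g x) := by
  simp_rw [frobInner_eq_sum]
  exact Finset.measurable_fun_sum _ fun i _ => Finset.measurable_fun_sum _ fun j _ =>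
    (hf i j).mul (hg i j)

lemma measurable_sampleCov_apply {k : ℕ} (i j : Fin d) :
    Measurable fun y : Fin k → Vec d => sampleCov y i j := by
  simp only [sampleCov, Matrix.of_apply]
  fun_prop

lemma measurable_normDev {k : ℕ} (D S : Mat d) :
    Measurable fun y : Fin k → Vec d => normDev D S y := by
  have h := measurable_frobInner (f := fun _ : Fin k → Vec d => D)
    (g := fun y => sampleCov y - S) (fun _ _ => measurable_const)
    fun i j => (measurable_sampleCov_apply i j).sub_const (S i j)
  exact h.div_const _

/-- This includes `frobNorm D = 0`: the quotient in `normDev` is then `0` by convention, and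
Cauchy–Schwarz makes the left side vanish too. -/
lemma abs_frobInner_sampleCov_sub {k : ℕ} (D S : Mat d) (y : Fin k → Vec d) :
    |frobInner D (sampleCov y - S)| = |normDev D S y| * frobNorm D := by
  rcases (frobNorm_nonneg D).eq_or_lt with h | h
  · have := abs_frobInner_le D (sampleCov y - S)
    rw [← h, zero_mul] at this
    rw [← h, mul_zero]
    exact le_antisymm this (abs_nonneg _)
  · rw [normDev, abs_div, abs_of_pos h, div_mul_cancel₀ _ h.ne']

lemma lintegral_exp_normDev {k : ℕ} (hk : 0 < k) {S : Mat d} (hS : S ∈ covSet d)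
    (D : Mat d) {c : ℝ} (hc : |c| ≤ k / 4) :
    ∫⁻ y, ENNReal.ofReal (Real.exp (c * normDev D S y)) ∂(sampleLaw k S)
      ≤ ENNReal.ofReal (Real.exp (2 * c ^ 2 / k)) := by
  rcases (frobNorm_nonneg D).eq_or_lt with h | h
  · simp only [normDev, ← h, div_zero, mul_zero, Real.exp_zero, lintegral_const, measure_univ,
      mul_one]
    exact ENNReal.ofReal_le_ofReal (Real.one_le_exp (by positivity))
  · have := lintegral_exp_frobInner_sampleCov hk hS D (c := c / frobNorm D) (by
      rwa [abs_div, abs_of_pos h, div_mul_cancel₀ _ h.ne'])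
    have e : ∀ y : Fin k → Vec d, c * normDev D S y
        = c / frobNorm D * frobInner D (sampleCov y - S) := fun y => by
      rw [normDev]; ring
    simp_rw [e]
    refine this.trans_eq ?_
    congr 3
    field_simp

/-- Turns exponential moments into a second moment of a maximum. Above the level `a` it uses `y² ≤
2a² + 2(y - a)²` and `(y - a)² ≤ 2 exp(y - a)`. -/
lemma sq_le_two_mul_sq_add_exp {x a : ℝ} (ha : 0 ≤ a) :
    x ^ 2 ≤ 2 * a ^ 2 + 4 * Real.exp (-a) * (Real.exp x + Real.exp (-x)) := by
  have key : ∀ y : ℝ, 0 ≤ y → y ^ 2 ≤ 2 * a ^ 2 + 4 * Real.exp (-a) * Real.exp y := by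
    intro y hy
    rw [mul_assoc, ← Real.exp_add]
    rcases le_total y a with h | h
    · nlinarith [Real.exp_pos (-a + y)]
    · have := Real.quadratic_le_exp_of_nonneg (x := -a + y) (by linarith)
      nlinarith [sq_nonneg (y - 2 * a)]
  have hp := Real.exp_pos (-a)
  rcases le_total 0 x with h | h
  · nlinarith [key x h, mul_pos hp (Real.exp_pos (-x))]
  · nlinarith [key (-x) (by linarith), mul_pos hp (Real.exp_pos x)]

/-- The maximum over `ι` is replaced by a sum only in the exponential term, so the cardinality costs
its logarithm, at most `L`. The condition `L ≤ k` keeps the exponential parameter in the range where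
the moment bound is Gaussian; for all permutations, `L = d log d`. -/
lemma lintegral_iSup_normDev_sq {ι : Type} [Fintype ι] {k : ℕ} {S : Mat d} (hS : S ∈ covSet d)
    (D : ι → Mat d) {L : ℝ} (hL : 1 ≤ L) (hLk : L ≤ k) (hcard : (Fintype.card ι : ℝ) ≤ Real.exp L) :
    ∫⁻ y, ⨆ i, ENNReal.ofReal (normDev (D i) S y ^ 2) ∂(sampleLaw k S)
      ≤ ENNReal.ofReal (200 * (L / k)) := by
  have hk0 : (0 : ℝ) < k := by linarith
  have hk : 0 < k := by exact_mod_cast hk0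
  have hL0 : 0 < L := by linarith
  -- With this `c` the exponential moment is at most `exp(2c²/k) = exp(L/8)`, and `c ≤ k/4` amounts
  -- to `L ≤ k`.
  set c : ℝ := √(k * L) / 4 with hc
  have hc2 : c ^ 2 = k * L / 16 := by
    rw [hc, div_pow, Real.sq_sqrt (by positivity)]; norm_num
  have hc0 : 0 < c := by positivity
  have hck : |c| ≤ k / 4 := by
    rw [abs_of_pos hc0]
    refine abs_le_of_sq_le_sq' ?_ (by positivity) |>.2
    rw [hc2]; nlinarith
  -- `a = L + L/8`, so `exp(-a)` offsets the cardinality `exp L` times the moment `exp(L/8)`.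
  set a : ℝ := 9 * L / 8 with ha
  have ha0 : 0 ≤ a := by positivity
  set p : ℝ := 2 * a ^ 2 / c ^ 2 with hp
  set q : ℝ := 4 * Real.exp (-a) / c ^ 2 with hq
  have hq0 : 0 ≤ q := by positivity
  have hpt : ∀ y : Fin k → Vec d, ⨆ i, ENNReal.ofReal (normDev (D i) S y ^ 2)
      ≤ ENNReal.ofReal p + ENNReal.ofReal q *
        ∑ i, (ENNReal.ofReal (Real.exp (c * normDev (D i) S y))
          + ENNReal.ofReal (Real.exp (-c * normDev (D i) S y))) := by
    intro y
    refine iSup_le fun i => ?_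
    have h1 : normDev (D i) S y ^ 2 ≤ p + q * (Real.exp (c * normDev (D i) S y)
        + Real.exp (-c * normDev (D i) S y)) := by
      have := sq_le_two_mul_sq_add_exp (x := c * normDev (D i) S y) ha0
      rw [mul_pow, ← neg_mul] at this
      rw [hp, hq, div_mul_eq_mul_div, ← add_div, le_div_iff₀ (by positivity)]
      linarith
    refine (ENNReal.ofReal_le_ofReal h1).trans ?_
    rw [ENNReal.ofReal_add (by positivity) (by positivity), ENNReal.ofReal_mul hq0,
      ENNReal.ofReal_add (by positivity) (by positivity)]
    gcongr
    exact Finset.single_le_sum (f := fun i => ENNReal.ofReal (Real.exp (c * normDev (D i) S y))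
          + ENNReal.ofReal (Real.exp (-c * normDev (D i) S y))) (fun _ _ => zero_le)
          (Finset.mem_univ i)
  have hm : ∀ (r : ℝ) (i : ι), Measurable fun y : Fin k → Vec d =>
      ENNReal.ofReal (Real.exp (r * normDev (D i) S y)) := fun r i => by
    have := measurable_normDev (k := k) (D i) S
    fun_prop
  have hm2 : ∀ i, Measurable fun y : Fin k → Vec d =>
      ENNReal.ofReal (Real.exp (c * normDev (D i) S y))
        + ENNReal.ofReal (Real.exp (-c * normDev (D i) S y)) := fun i => (hm c i).add (hm (-c) i)
  have h2 : 2 * c ^ 2 / k = L / 8 := by rw [hc2]; field_simp; norm_num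
  calc _ ≤ _ := lintegral_mono hpt
    _ = ENNReal.ofReal p + ENNReal.ofReal q *
        ∑ i, (∫⁻ y, ENNReal.ofReal (Real.exp (c * normDev (D i) S y)) ∂(sampleLaw k S)
          + ∫⁻ y, ENNReal.ofReal (Real.exp (-c * normDev (D i) S y)) ∂(sampleLaw k S)) := by
      rw [lintegral_add_left measurable_const, lintegral_const, measure_univ, mul_one,
        lintegral_const_mul _ (Finset.measurable_fun_sum _ fun i _ => hm2 i),
        lintegral_finsetSum _ fun i _ => hm2 i]
      simp_rw [lintegral_add_left (hm c _)]
    _ ≤ ENNReal.ofReal p + ENNReal.ofReal q *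
        ∑ _i : ι, (ENNReal.ofReal (Real.exp (L / 8)) + ENNReal.ofReal (Real.exp (L / 8))) := by
      gcongr with i
      · rw [← h2]; exact lintegral_exp_normDev hk hS (D i) hck
      · rw [← h2, ← neg_sq c]
        exact lintegral_exp_normDev hk hS (D i) (by rwa [abs_neg])
    _ = ENNReal.ofReal (p + q * (Fintype.card ι * (Real.exp (L / 8) + Real.exp (L / 8)))) := by
      rw [Finset.sum_const, Finset.card_univ, nsmul_eq_mul,
        ← ENNReal.ofReal_add (by positivity) (by positivity), ← ENNReal.ofReal_natCast,
        ← ENNReal.ofReal_mul (by positivity), ← ENNReal.ofReal_mul hq0,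
        ← ENNReal.ofReal_add (by positivity) (by positivity)]
    _ ≤ _ := by
      refine ENNReal.ofReal_le_ofReal ?_
      have h3 : q * (Fintype.card ι * (Real.exp (L / 8) + Real.exp (L / 8))) ≤ 8 / c ^ 2 := by
        calc _ ≤ q * (Real.exp L * (Real.exp (L / 8) + Real.exp (L / 8))) := by gcongr
          _ = 8 / c ^ 2 * (Real.exp (-a) * Real.exp L * Real.exp (L / 8)) := by rw [hq]; ring
          _ = _ := by
            rw [← Real.exp_add, ← Real.exp_add, ha]
            ring_nf
            simp
      calc _ ≤ p + 8 / c ^ 2 := by linarith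
        _ ≤ _ := by
          rw [hp, ← add_div, hc2, ha, ← mul_div_assoc, div_le_div_iff₀ (by positivity) hk0]
          nlinarith [mul_pos hk0 hL0, mul_le_mul hL hL zero_le_one hL0.le]

/-! ### The alignment inequality and the risk of Gromov–Wasserstein estimators -/

lemma frobNorm_sq_le_of_alignment {S T B : Mat d} {π ρ : Equiv.Perm (Fin d)} {s w z : ℝ}
    (hs : 0 < s) (hz0 : 0 ≤ z)
    (h : frobInner (permute π T) B ≤ frobInner (permute ρ T) B)
    (hz : |frobInner (permute ρ T - permute π T) (B - permute π S)|
      ≤ z * frobNorm (permute ρ T - permute π T))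
    (hw : |frobInner (permute ρ (T - S)) (permute ρ S - permute π S)|
      ≤ w * frobNorm (permute ρ S - permute π S)) :
    frobNorm (permute ρ S - permute π S) ^ 2
      ≤ 8 * w ^ 2 + (8 + 4 / s) * z ^ 2 + 4 * s * frobNorm (T - S) ^ 2 := by
  set x := frobNorm (permute ρ S - permute π S) with hx
  set e := frobNorm (T - S) with he
  have hD : frobNorm (permute ρ T - permute π T) ≤ x + 2 * e := by
    have e1 : permute ρ T - permute π T = (permute ρ S - permute π S)
        + (permute ρ (T - S) - permute π (T - S)) := by
      rw [permute_sub, permute_sub]; abel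
    have h1 := frobNorm_add_le (permute ρ S - permute π S)
      (permute ρ (T - S) - permute π (T - S))
    have h2 := frobNorm_sub_le (permute ρ (T - S)) (permute π (T - S))
    rw [frobNorm_permute, frobNorm_permute] at h2
    rw [e1]; linarith
  have h1 := (le_abs_self _).trans (hz.trans (mul_le_mul_of_nonneg_left hD hz0))
  have h2 := (neg_abs_le _).trans' (neg_le_neg hw)
  have h3 : x ^ 2 = 2 * frobInner (permute π S) (permute π S)
      - 2 * frobInner (permute ρ S) (permute π S) := by
    have := frobInner_permute ρ S S
    have h' := frobInner_permute π S S
    rw [hx, ← frobInner_self, frobInner_sub_left, frobInner_sub_right, frobInner_sub_right,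
      frobInner_comm (permute π S) (permute ρ S)]
    linarith
  have h4 : frobInner (permute ρ T) (permute ρ S) = frobInner T S := frobInner_permute _ _ _
  have h5 : frobInner (permute π T) (permute π S) = frobInner T S := frobInner_permute _ _ _
  have h6 : frobInner (permute ρ S) (permute ρ S) = frobInner S S := frobInner_permute _ _ _
  have h7 : frobInner (permute π S) (permute π S) = frobInner S S := frobInner_permute _ _ _
  simp only [permute_sub, frobInner_sub_left, frobInner_sub_right] at h1 h2
  -- Permutation invariance gives `⟨T^ρ - T^π, S^π⟩ = -⟨T^ρ, S^ρ - S^π⟩`. Splitting `T = S + (T -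
  -- S)` on the right, the `S` part contributes `x²/2` and the rest is controlled by `w`; optimality
  -- of `ρ` bounds the total by the noise term in `z`.
  have main : x ^ 2 / 2 ≤ w * x + z * (x + 2 * e) := by linarith
  have h8 : 2 * (z * e) ≤ s * e ^ 2 + z ^ 2 / s := by
    have : 0 ≤ (s * e - z) ^ 2 / s := by positivity
    have e2 : (s * e - z) ^ 2 / s = s * e ^ 2 + z ^ 2 / s - 2 * (z * e) := by
      field_simp; ring
    linarith
  have h9 : 4 / s * z ^ 2 = 4 * (z ^ 2 / s) := by ring
  -- The squares encode `w x ≤ x²/8 + 2w²` and the same for `z`, which absorbs half of `x²/2`.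
  nlinarith [sq_nonneg (x - 4 * w), sq_nonneg (x - 4 * z)]

/-- Ties are broken by a fixed numbering of the permutations, so each level set of the selection is
a finite Boolean combination of comparisons between measurable functions. -/
lemma exists_estimator_argmax {X : Type} [MeasurableSpace X] (f : Equiv.Perm (Fin d) → X → ℝ)
    (hf : ∀ π, Measurable (f π)) :
    ∃ e : Estimator X d, ∀ x π, f π x ≤ f (e.toFun x) x := by
  classical
  let ε := Fintype.equivFin (Equiv.Perm (Fin d))
  let P : Equiv.Perm (Fin d) → X → Prop := fun π x =>
    (∀ ρ, f ρ x ≤ f π x) ∧ ∀ σ, ε σ < ε π → ¬∀ ρ, f ρ x ≤ f σ x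
  have hex : ∀ x, ∃ π, P π x := by
    intro x
    obtain ⟨π₀, hπ₀⟩ := Finite.exists_max fun π => f π x
    obtain ⟨π, hπ, hmin⟩ := (Finset.univ.filter fun π => ∀ ρ, f ρ x ≤ f π x).exists_min_image ε
      ⟨π₀, by simpa using hπ₀⟩
    refine ⟨π, by simpa using hπ, fun σ hσ h => ?_⟩
    exact absurd (hmin σ (by simpa using h)) (not_le.2 hσ)
  choose g hg using hex
  refine ⟨⟨g, fun π => ?_⟩, fun x π => (hg x).1 π⟩
  have : g ⁻¹' {π} = {x | P π x} := by
    ext x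
    simp only [Set.mem_preimage, Set.mem_singleton_iff, Set.mem_ofPred_eq]
    refine ⟨fun h => h ▸ hg x, fun h => ?_⟩
    rcases lt_trichotomy (ε (g x)) (ε π) with hlt | heq | hlt
    · exact absurd (hg x).1 (h.2 _ hlt)
    · exact ε.injective heq
    · exact absurd h.1 ((hg x).2 _ hlt)
  rw [this]
  have hM : ∀ σ, MeasurableSet {x | ∀ ρ, f ρ x ≤ f σ x} := fun σ => by
    simp only [Set.ofPred_forall]
    exact MeasurableSet.iInter fun ρ => measurableSet_le (hf ρ) (hf σ)
  refine (hM π).inter ?_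
  change MeasurableSet {x | ∀ σ, ε σ < ε π → ¬∀ ρ, f ρ x ≤ f σ x}
  simp only [Set.ofPred_forall]
  exact MeasurableSet.iInter fun σ => MeasurableSet.iInter fun _ => (hM σ).compl

lemma measurable_mat_apply (i j : Fin d) : Measurable fun T : Mat d => T i j :=
  (measurable_pi_apply j).comp (measurable_pi_apply (X := fun _ => Fin d → ℝ) i)

lemma exists_isGW (d n : ℕ) : ∃ e : Estimator (OracleObs d n) d, IsGW e := by
  obtain ⟨e, he⟩ := exists_estimator_argmax (X := OracleObs d n)
    (fun π z => frobInner (permute π z.2) (sampleCov z.1)) fun π =>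
      measurable_frobInner (fun i j => (measurable_mat_apply (π i) (π j)).comp measurable_snd)
        fun i j => (measurable_sampleCov_apply i j).comp measurable_fst
  exact ⟨e, fun y T π => he (y, T) π⟩

lemma card_perm_le_exp (hd : 2 ≤ d) :
    (Fintype.card (Equiv.Perm (Fin d)) : ℝ) ≤ Real.exp (d * Real.log d) := by
  rw [Fintype.card_perm, Fintype.card_fin, mul_comm, Real.exp_mul, Real.exp_log (by positivity),
    Real.rpow_natCast]
  exact_mod_cast Nat.factorial_le_pow d

lemma one_le_mul_log (hd : 2 ≤ d) : 1 ≤ (d : ℝ) * Real.log d := by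
  have hd' : (2 : ℝ) ≤ d := by exact_mod_cast hd
  have h1 := Real.log_two_gt_d9
  have h2 := Real.log_le_log two_pos hd'
  nlinarith

lemma lintegral_iSup_normDev_perm_sq {k : ℕ} (hd : 2 ≤ d) (hk : (d : ℝ) * Real.log d ≤ k)
    {S : Mat d} (hS : S ∈ covSet d) (D : Equiv.Perm (Fin d) → Mat d) :
    ∫⁻ y, ⨆ ρ, ENNReal.ofReal (normDev (D ρ) S y ^ 2) ∂(sampleLaw k S)
      ≤ ENNReal.ofReal (200 * (d * Real.log d / k)) :=
  lintegral_iSup_normDev_sq hS D (one_le_mul_log hd) hk (card_perm_le_exp hd)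

lemma measurable_iSup_normDev_sq {ι : Type} [Finite ι] {k : ℕ} (D : ι → Mat d) (S : Mat d) :
    Measurable fun y : Fin k → Vec d => ⨆ i, ENNReal.ofReal (normDev (D i) S y ^ 2) :=
  Measurable.iSup fun i => ((measurable_normDev (D i) S).pow_const 2).ennreal_ofReal

/-- The loss of the maximizer of `⟨T^π, Σ̂_Y⟩` in terms of the errors of `T` and of `Σ̂_Y`. -/
lemma loss_le_of_argmax {n : ℕ} {S T : Mat d} {π ρ : Equiv.Perm (Fin d)} {y : Fin n → Vec d}
    {s w : ℝ} (hs : 0 < s)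
    (h : frobInner (permute π T) (sampleCov y) ≤ frobInner (permute ρ T) (sampleCov y))
    (hw : |frobInner (permute ρ (T - S)) (permute ρ S - permute π S)|
      ≤ w * frobNorm (permute ρ S - permute π S)) :
    loss S π ρ ≤ ENNReal.ofReal (8 * w ^ 2) + ENNReal.ofReal (4 * s * frobNorm (T - S) ^ 2)
      + ENNReal.ofReal (8 + 4 / s) * ⨆ σ : Equiv.Perm (Fin d), ENNReal.ofReal
          (normDev (permute σ T - permute π T) (permute π S) y ^ 2) := by
  have h1 := frobNorm_sq_le_of_alignment hs (abs_nonneg _) h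
    (abs_frobInner_sampleCov_sub (permute ρ T - permute π T) (permute π S) y).le hw
  rw [sq_abs] at h1
  refine (ENNReal.ofReal_le_ofReal (h1.trans_eq (add_right_comm _ _ _))).trans ?_
  rw [ENNReal.ofReal_add (by positivity) (by positivity),
    ENNReal.ofReal_add (by positivity) (by positivity),
    ENNReal.ofReal_mul (p := 8 + 4 / s) (by positivity)]
  gcongr
  exact le_iSup (fun σ : Equiv.Perm (Fin d) => ENNReal.ofReal
          (normDev (permute σ T - permute π T) (permute π S) y ^ 2)) ρ

theorem oracleRisk_le_of_isGW {m n : ℕ} (hd : 2 ≤ d) (hm : 0 < m) (hn : (d : ℝ) * Real.log d ≤ n)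
    {e : Estimator (OracleObs d n) d} (he : IsGW e) :
    oracleRisk m n e ≤ ENNReal.ofReal (2400 * oracleRate d m n) := by
  refine iSup_le fun π => iSup_le fun S => iSup_le fun hS => iSup_le fun Q => iSup_le fun hQ => ?_
  have hm' : (0 : ℝ) < m := by positivity
  have hL : 0 ≤ (d : ℝ) * Real.log d := zero_le_one.trans (one_le_mul_log hd)
  have hS' := permute_mem_covSet π hS
  -- The oracle's output is integrated last: for fixed `T` the directions `T^σ - T^π` do not depend
  -- on the sample.
  rw [← lintegral_prod_swap]
  refine (lintegral_prod_le _).trans ?_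
  have key : ∀ᵐ T ∂(Q : Measure (Mat d)),
      ∫⁻ y, loss S π (e.toFun (T, y).swap) ∂(sampleLaw n (permute π S))
        ≤ ENNReal.ofReal (2400 * oracleRate d m n) := by
    filter_upwards [hQ] with T hT
    have hE : frobNorm (T - S) ^ 2 ≤ (d : ℝ) ^ 2 / m := by
      refine (frobNorm_sq_le _).trans ?_
      have h1 := pow_le_pow_left₀ (opNorm_nonneg _) hT 2
      rw [Real.sq_sqrt (by positivity)] at h1
      calc (d : ℝ) * opNorm (T - S) ^ 2 ≤ d * (d / m) := by gcongr
        _ = _ := by ring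
    have hpt : ∀ y : Fin n → Vec d, loss S π (e.toFun (T, y).swap) ≤
        ENNReal.ofReal (12 * ((d : ℝ) ^ 2 / m)) + ENNReal.ofReal 12 *
          ⨆ σ : Equiv.Perm (Fin d), ENNReal.ofReal
            (normDev (permute σ T - permute π T) (permute π S) y ^ 2) := by
      intro y
      refine (loss_le_of_argmax one_pos (w := frobNorm (T - S)) (he y T π) ?_).trans ?_
      · rw [← frobNorm_permute (e.toFun (y, T)) (T - S)]
        exact abs_frobInner_le _ _
      · rw [← ENNReal.ofReal_add (by positivity) (by positivity)]
        norm_num only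
        gcongr
        linarith
    refine (lintegral_mono hpt).trans ?_
    rw [lintegral_add_left measurable_const, lintegral_const, measure_univ, mul_one,
      lintegral_const_mul _ (measurable_iSup_normDev_sq _ _)]
    refine (add_le_add_right (mul_le_mul_right
      (lintegral_iSup_normDev_perm_sq hd hn hS' _) _) _).trans ?_
    rw [← ENNReal.ofReal_mul (by norm_num), ← ENNReal.ofReal_add (by positivity) (by positivity)]
    refine ENNReal.ofReal_le_ofReal ?_
    rw [oracleRate]
    have : 0 ≤ (d : ℝ) ^ 2 / m := by positivity
    linarith
  refine (lintegral_mono_ae key).trans ?_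
  rw [lintegral_const, measure_univ, mul_one]

/-! ### The upper bound in the original model -/

lemma frobInner_single (i j : Fin d) (A : Mat d) : frobInner (Matrix.single i j 1) A = A i j := by
  rw [frobInner_eq_sum, Finset.sum_eq_single i, Finset.sum_eq_single j] <;>
    simp +contextual [Matrix.single_apply, eq_comm]

lemma frobNorm_single (i j : Fin d) : frobNorm (Matrix.single i j (1 : ℝ)) = 1 := by
  rw [frobNorm, frobInner_single]; simp

/-- Each of the `d²` entries is a deviation in one unit direction, covered by the uniform bound with
a one-point family and `L = 1`. -/
lemma lintegral_frobNorm_sampleCov_sub_sq {k : ℕ} (hk : 0 < k) {S : Mat d} (hS : S ∈ covSet d) :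
    ∫⁻ x, ENNReal.ofReal (frobNorm (sampleCov x - S) ^ 2) ∂(sampleLaw k S)
      ≤ ENNReal.ofReal (200 * ((d : ℝ) ^ 2 / k)) := by
  have h1 : ∀ x : Fin k → Vec d, ENNReal.ofReal (frobNorm (sampleCov x - S) ^ 2)
      = ∑ i, ∑ j, ⨆ _ : Unit, ENNReal.ofReal (normDev (Matrix.single i j 1) S x ^ 2) := by
    intro x
    rw [frobNorm_sq, ENNReal.ofReal_sum_of_nonneg fun i _ => by positivity]
    refine Finset.sum_congr rfl fun i _ => ?_
    rw [ENNReal.ofReal_sum_of_nonneg fun i _ => by positivity]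
    refine Finset.sum_congr rfl fun j _ => ?_
    rw [iSup_const, normDev, frobInner_single, frobNorm_single, div_one]
  have hm : ∀ i j, Measurable fun x : Fin k → Vec d =>
      ⨆ _ : Unit, ENNReal.ofReal (normDev (Matrix.single i j 1) S x ^ 2) := fun i j =>
    measurable_iSup_normDev_sq (fun _ : Unit => Matrix.single i j 1) S
  simp_rw [h1]
  rw [lintegral_finsetSum _ fun i _ => Finset.measurable_fun_sum _ fun j _ => hm i j]
  simp_rw [lintegral_finsetSum _ fun j _ => hm _ j]
  have h2 : ∀ i j, ∫⁻ x : Fin k → Vec d, (⨆ _ : Unit, ENNReal.ofReal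
      (normDev (Matrix.single i j 1) S x ^ 2)) ∂(sampleLaw k S) ≤ ENNReal.ofReal (200 * (1 / k)) :=
    fun i j => lintegral_iSup_normDev_sq hS (fun _ : Unit => Matrix.single i j 1) le_rfl
      (by exact_mod_cast hk) (by simp)
  refine (Finset.sum_le_sum fun i _ => Finset.sum_le_sum fun j _ => h2 i j).trans_eq ?_
  simp only [Finset.sum_const, Finset.card_univ, Fintype.card_fin, nsmul_eq_mul]
  rw [← ENNReal.ofReal_natCast, ← ENNReal.ofReal_mul (by positivity),
    ← ENNReal.ofReal_mul (by positivity)]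
  congr 1
  ring

/-- The estimator aligns the two sample covariances. The parameter `s` weighs the full error of the
first one, of order `d²/m`, against the noise of the second, of order `d log d / n`. -/
theorem originalMinimax_le {m n : ℕ} (hd : 2 ≤ d) (hmn : n ≤ m) (hn : (d : ℝ) * Real.log d ≤ n)
    {s : ℝ} (hs : 0 < s) :
    originalMinimax d m n ≤ ENNReal.ofReal (800 * ((4 + 1 / s) * (d * Real.log d / n)
      + s * ((d : ℝ) ^ 2 / m))) := by
  have hL := one_le_mul_log hd
  have hn0 : (0 : ℝ) < n := by linarith
  have hmn' : (n : ℝ) ≤ m := by exact_mod_cast hmn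
  have hm0 : (0 : ℝ) < m := by linarith
  have hm : 0 < m := by exact_mod_cast hm0
  obtain ⟨e, he⟩ := exists_estimator_argmax (X := SampleObs d m n)
    (fun π z => frobInner (permute π (sampleCov z.1)) (sampleCov z.2)) fun π =>
      measurable_frobInner
        (fun i j => (measurable_sampleCov_apply (π i) (π j)).comp measurable_fst)
        fun i j => (measurable_sampleCov_apply i j).comp measurable_snd
  refine iInf_le_of_le e (iSup_le fun π => iSup_le fun S => iSup_le fun hS => ?_)
  have hS' := permute_mem_covSet π hS
  refine (lintegral_prod_le _).trans ?_
  -- Moving `ρ` to the other side of the inner product leaves `T - S` tested against directions that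
  -- do not depend on `x`, so the union bound applies to the first sample as well.
  let D : Equiv.Perm (Fin d) → Mat d := fun ρ => permute ρ⁻¹ (permute ρ S - permute π S)
  have key : ∀ x : Fin m → Vec d,
      ∫⁻ y, loss S π (e.toFun (x, y)) ∂(sampleLaw n (permute π S))
        ≤ (ENNReal.ofReal 8 * (⨆ ρ, ENNReal.ofReal (normDev (D ρ) S x ^ 2))
          + ENNReal.ofReal (4 * s) * ENNReal.ofReal (frobNorm (sampleCov x - S) ^ 2))
          + ENNReal.ofReal (8 + 4 / s) * ENNReal.ofReal (200 * (d * Real.log d / n)) := by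
    intro x
    have hpt : ∀ y : Fin n → Vec d, loss S π (e.toFun (x, y)) ≤
        (ENNReal.ofReal 8 * (⨆ ρ, ENNReal.ofReal (normDev (D ρ) S x ^ 2))
          + ENNReal.ofReal (4 * s) * ENNReal.ofReal (frobNorm (sampleCov x - S) ^ 2))
          + ENNReal.ofReal (8 + 4 / s) * ⨆ σ : Equiv.Perm (Fin d), ENNReal.ofReal
            (normDev (permute σ (sampleCov x) - permute π (sampleCov x)) (permute π S) y ^ 2) := by
      intro y
      refine (loss_le_of_argmax hs (w := |normDev (D (e.toFun (x, y))) S x|)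
        (he (x, y) π) ?_).trans ?_
      · rw [frobInner_permute_left, frobInner_comm]
        refine (abs_frobInner_sampleCov_sub (D (e.toFun (x, y))) S x).le.trans_eq ?_
        rw [frobNorm_permute]
      · rw [sq_abs, ENNReal.ofReal_mul (by norm_num), ENNReal.ofReal_mul (p := 4 * s)
          (by positivity)]
        gcongr
        exact le_iSup (fun ρ => ENNReal.ofReal (normDev (D ρ) S x ^ 2)) _
    refine (lintegral_mono hpt).trans ?_
    rw [lintegral_add_left measurable_const, lintegral_const, measure_univ, mul_one,
      lintegral_const_mul _ (measurable_iSup_normDev_sq _ _)]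
    gcongr
    exact lintegral_iSup_normDev_perm_sq hd hn hS' _
  refine (lintegral_mono key).trans ?_
  rw [lintegral_add_right _ measurable_const, lintegral_const, measure_univ, mul_one,
    lintegral_add_left ((measurable_iSup_normDev_sq _ _).const_mul _),
    lintegral_const_mul _ (measurable_iSup_normDev_sq _ _),
    lintegral_const_mul' _ _ ENNReal.ofReal_ne_top]
  refine (add_le_add_left (add_le_add (mul_le_mul_right
    (lintegral_iSup_normDev_perm_sq hd (hn.trans hmn') hS D) _) (mul_le_mul_right
    (lintegral_frobNorm_sampleCov_sub_sq hm hS) _)) _).trans ?_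
  rw [← ENNReal.ofReal_mul (by norm_num), ← ENNReal.ofReal_mul (by positivity),
    ← ENNReal.ofReal_mul (by positivity), ← ENNReal.ofReal_add (by positivity) (by positivity),
    ← ENNReal.ofReal_add (by positivity) (by positivity)]
  refine ENNReal.ofReal_le_ofReal ?_
  have h1 : (d : ℝ) * Real.log d / m ≤ d * Real.log d / n := by gcongr
  have h2 : (0 : ℝ) ≤ d * Real.log d / n := by positivity
  rw [show 4 / s = 4 * (1 / s) by ring]
  linarith

/-! ### Lower bound from indistinguishable oracles -/

lemma Estimator.measurable_comp {X α : Type} [MeasurableSpace X] [MeasurableSpace α]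
    (e : Estimator X d) (g : Equiv.Perm (Fin d) → α) : Measurable fun x => g (e.toFun x) := by
  let _ : MeasurableSpace (Equiv.Perm (Fin d)) := ⊤
  exact (measurable_from_top (f := g)).comp (measurable_to_countable' e.measurable)

instance : MeasurableSingletonClass (Mat d) :=
  inferInstanceAs (MeasurableSingletonClass (Fin d → Fin d → ℝ))

/-- The oracle that always returns the matrix `T`. -/
noncomputable def constOracle (T : Mat d) : ProbabilityMeasure (Mat d) :=
  ⟨Measure.dirac T, inferInstance⟩

lemma isOracle_constOracle {m : ℕ} {S T : Mat d} (h : opNorm (T - S) ≤ √((d : ℝ) / m)) :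
    IsOracle m S (constOracle T) := by
  change ∀ᵐ T' ∂(Measure.dirac T), _
  rw [ae_dirac_eq]
  exact h

lemma le_oracleRisk {m n : ℕ} (e : Estimator (OracleObs d n) d) (π : Equiv.Perm (Fin d))
    {S T : Mat d} (hS : S ∈ covSet d) (hT : opNorm (T - S) ≤ √((d : ℝ) / m)) :
    ∫⁻ z, loss S π (e.toFun z) ∂((sampleLaw n (permute π S)).prod (Measure.dirac T))
      ≤ oracleRisk m n e :=
  le_iSup_of_le π <| le_iSup_of_le S <| le_iSup_of_le hS <| le_iSup_of_le (constOracle T) <|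
    le_iSup_of_le (isOracle_constOracle hT) le_rfl

/-- Under `(1, B)` and `(τ, B^τ)` the sample has covariance `B`, as `τ² = 1`, and `T` is admissible
for both. The same guess `ρ` is thus judged under one law by `‖B^ρ - B‖_F` and `‖(B^τ)^ρ - B‖_F`,
whose sum is at least `‖B^τ - B‖_F`. -/
lemma ofReal_frobNorm_permute_sub_le_oracleRisk {m n : ℕ} (e : Estimator (OracleObs d n) d)
    {B T : Mat d} {τ : Equiv.Perm (Fin d)} (hτ : τ * τ = 1) (hB : B ∈ covSet d)
    (hT : opNorm (T - B) ≤ √((d : ℝ) / m)) (hT' : opNorm (T - permute τ B) ≤ √((d : ℝ) / m)) :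
    ENNReal.ofReal (frobNorm (permute τ B - B) ^ 2 / 4) ≤ oracleRisk m n e := by
  have h1 := le_oracleRisk e 1 hB hT
  have h2 := le_oracleRisk e τ (permute_mem_covSet τ hB) hT'
  rw [permute_permute, hτ] at h2
  rw [permute_one] at h1 h2
  have h3 := add_le_add h1 h2
  rw [← lintegral_add_left (e.measurable_comp _)] at h3
  have h4 : ENNReal.ofReal (frobNorm (permute τ B - B) ^ 2 / 2)
      ≤ oracleRisk m n e + oracleRisk m n e := by
    refine le_trans ?_ h3
    have : ∀ z, ENNReal.ofReal (frobNorm (permute τ B - B) ^ 2 / 2)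
        ≤ loss B 1 (e.toFun z) + loss (permute τ B) τ (e.toFun z) := by
      intro z
      rw [loss, loss, ← ENNReal.ofReal_add (sq_nonneg _) (sq_nonneg _)]
      refine ENNReal.ofReal_le_ofReal ?_
      set ρ := e.toFun z
      have e1 : permute τ (permute τ B) = B := by rw [permute_permute, hτ, permute_one]
      have e2 : frobNorm (permute τ B - B) = frobNorm (permute ρ (permute τ B) - permute ρ B) := by
        rw [← permute_sub, frobNorm_permute]
      have h5 := frobNorm_sub_le_sub_add_sub (permute ρ (permute τ B)) B (permute ρ B)
      rw [e1, permute_one, e2]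
      rw [frobNorm_sub_comm B] at h5
      have h6 := frobNorm_nonneg (permute ρ (permute τ B) - permute ρ B)
      nlinarith [sq_nonneg (frobNorm (permute ρ (permute τ B) - B) - frobNorm (permute ρ B - B))]
    refine le_trans ?_ (lintegral_mono this)
    rw [lintegral_const, measure_univ, mul_one]
  rw [← two_mul, show frobNorm (permute τ B - B) ^ 2 / 2
    = 2 * (frobNorm (permute τ B - B) ^ 2 / 4) by ring, ENNReal.ofReal_mul zero_le_two,
    ENNReal.ofReal_ofNat] at h4
  exact (ENNReal.mul_le_mul_iff_right two_ne_zero ENNReal.ofNat_ne_top).1 h4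

/-- The lower bound caused by the imprecision of the oracle. -/
theorem dim_sq_div_le_oracleRisk {m n : ℕ} (hd : 2 ≤ d) (hm : (d : ℝ) ≤ 2 * m)
    (e : Estimator (OracleObs d n) d) :
    ENNReal.ofReal ((d : ℝ) ^ 2 / m / 200) ≤ oracleRisk m n e := by
  have hd' : (2 : ℝ) ≤ d := by exact_mod_cast hd
  have hm0 : (0 : ℝ) < m := by linarith
  set δ : ℝ := √((d : ℝ) / m) / 4 with hδ
  have hδ0 : 0 ≤ δ := by positivity
  have hδ2 : δ ^ 2 = d / m / 16 := by
    rw [hδ, div_pow, Real.sq_sqrt (by positivity)]; norm_num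
  have hδ1 : δ ≤ 1 / 2 := by
    refine abs_le_of_sq_le_sq' ?_ (by norm_num) |>.2
    rw [hδ2, div_div, div_le_iff₀ (by positivity)]
    linarith
  have hδm : δ ≤ √((d : ℝ) / m) := by
    rw [hδ]; linarith [Real.sqrt_nonneg ((d : ℝ) / m)]
  -- Reversal exchanges the raised half of the diagonal with unraised entries. For odd `d` the
  -- middle index stays unraised.
  let v : Fin d → ℝ := fun i => if i.val < d / 2 then δ else 0
  have hv : ∀ i, 0 ≤ v i ∧ v i ≤ δ := fun i => by
    by_cases h : i.val < d / 2 <;> simp [v, h, hδ0]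
  set B : Mat d := Matrix.diagonal fun i => 1 / 2 + v i with hB
  set T : Mat d := Matrix.diagonal fun _ => 1 / 2 with hT
  have hBcov : B ∈ covSet d := by
    refine ⟨Matrix.posDef_diagonal_iff.2 fun i => by linarith [(hv i).1], ?_⟩
    refine opNorm_diagonal_le zero_le_one fun i => ?_
    rw [abs_of_nonneg (by linarith [(hv i).1])]
    linarith [(hv i).2]
  have hTB : opNorm (T - B) ≤ √((d : ℝ) / m) := by
    refine le_trans ?_ hδm
    rw [hT, hB, Matrix.diagonal_sub]
    refine opNorm_diagonal_le hδ0 fun i => ?_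
    rw [abs_le]
    constructor <;> linarith [(hv i).1, (hv i).2]
  have hTB' : opNorm (T - permute Fin.revPerm B) ≤ √((d : ℝ) / m) := by
    have : T - permute Fin.revPerm B = permute Fin.revPerm (T - B) := by
      rw [permute_sub]
      congr 1
      rw [permute_eq_submatrix, hT, Matrix.submatrix_diagonal_equiv]
      rfl
    rw [this]
    exact (opNorm_permute _ _).trans hTB
  refine le_trans (ENNReal.ofReal_le_ofReal ?_) (ofReal_frobNorm_permute_sub_le_oracleRisk e
    (τ := Fin.revPerm) (by ext; simp) hBcov hTB hTB')
  have h1 : ((d / 2 : ℕ) : ℝ) * δ ^ 2 ≤ frobNorm (permute Fin.revPerm B - B) ^ 2 := by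
    have hcard : (Finset.univ.filter fun i : Fin d => i.val < d / 2).card = d / 2 := by
      rw [Fin.card_filter_val_lt]; omega
    rw [frobNorm_sq]
    calc ((d / 2 : ℕ) : ℝ) * δ ^ 2
        = ∑ i ∈ Finset.univ.filter (fun i : Fin d => i.val < d / 2), δ ^ 2 := by
          rw [Finset.sum_const, hcard, nsmul_eq_mul]
      _ ≤ ∑ i ∈ Finset.univ.filter (fun i : Fin d => i.val < d / 2),
            ∑ j, (permute Fin.revPerm B - B) i j ^ 2 := by
          refine Finset.sum_le_sum fun i hi => ?_
          have hi' : i.val < d / 2 := by simpa using hi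
          refine le_trans (le_of_eq ?_) (Finset.single_le_sum
            (f := fun j => (permute Fin.revPerm B - B) i j ^ 2) (fun j _ => sq_nonneg _)
            (Finset.mem_univ i))
          have h2 : ¬(i.rev.val < d / 2) := by rw [Fin.val_rev]; omega
          simp only [Matrix.sub_apply, permute_apply, hB, Fin.revPerm_apply,
            Matrix.diagonal_apply_eq, v, if_pos hi', if_neg h2]
          ring
      _ ≤ _ := Finset.sum_le_sum_of_subset_of_nonneg (Finset.subset_univ _)
          fun i _ _ => Finset.sum_nonneg fun j _ => sq_nonneg _
  have h2 : (d : ℝ) / 3 ≤ ((d / 2 : ℕ) : ℝ) := by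
    have : d ≤ 3 * (d / 2) := by omega
    have : (d : ℝ) ≤ 3 * ((d / 2 : ℕ) : ℝ) := by exact_mod_cast this
    linarith
  have h3 := (mul_le_mul_of_nonneg_right h2 (sq_nonneg δ)).trans h1
  rw [hδ2] at h3
  have h4 : (d : ℝ) / 3 * (d / m / 16) = (d : ℝ) ^ 2 / m / 48 := by ring
  have h5 : 0 ≤ (d : ℝ) ^ 2 / m := by positivity
  linarith

/-! ### `χ²`-comparison of Gaussian samples with `N(0, I/2)` -/

lemma multivariateGaussian_eq_map_pi {S : Mat d} (hS : S.PosSemidef)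
    (b : OrthonormalBasis (Fin d) ℝ (Vec d)) (s : Fin d → NNReal)
    (h : ∀ i, Matrix.toEuclideanCLM (𝕜 := ℝ) S (b i) = (s i : ℝ) • b i) :
    multivariateGaussian 0 S
      = (Measure.pi fun i => gaussianReal 0 (s i)).map fun x => ∑ i, x i • b i := by
  refine Measure.ext_of_charFun (E := Vec d) ?_
  ext t
  have hquad : t.ofLp ⬝ᵥ S.mulVec t.ofLp = ∑ i, (s i : ℝ) * inner ℝ (b i) t ^ 2 := by
    rw [← Matrix.inner_toEuclideanCLM, ← b.sum_inner_mul_inner]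
    refine Finset.sum_congr rfl fun i _ => ?_
    rw [inner_toEuclideanCLM_comm hS.1, h, real_inner_smul_left, real_inner_comm t]
    ring
  rw [charFun_multivariateGaussian hS, hquad, charFun_apply, integral_map
    (Measurable.aemeasurable (by fun_prop)) (Measurable.aestronglyMeasurable (by fun_prop))]
  simp_rw [sum_inner, Complex.ofReal_sum, Finset.sum_mul, Complex.exp_sum]
  rw [integral_fintype_prod_eq_prod
    (f := fun i (x : ℝ) => Complex.exp (inner ℝ (x • b i) t * Complex.I))]
  simp_rw [real_inner_smul_left, mul_comm _ (inner ℝ (b _) t), Complex.ofReal_mul,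
    ← charFun_apply_real, charFun_gaussianReal]
  rw [← Complex.exp_sum]
  congr 1
  simp [← Finset.sum_div, Finset.sum_neg_distrib]

lemma toEuclideanCLM_smul_one (c : ℝ) (x : Vec d) :
    Matrix.toEuclideanCLM (𝕜 := ℝ) (c • (1 : Mat d)) x = c • x := by
  rw [map_smul, map_one]; rfl

lemma eigenvalues_near_half {S : Mat d} (hS : S.IsHermitian)
    (h : frobNorm ((2 : ℝ) • S - 1) ^ 2 ≤ 1 / 4) :
    ∑ i, (2 * hS.eigenvalues i - 1) ^ 2 = frobNorm ((2 : ℝ) • S - 1) ^ 2 ∧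
      ∀ i, (2 * hS.eigenvalues i - 1) ^ 2 ≤ 1 / 4 := by
  have h1 : ((2 : ℝ) • S - 1).IsHermitian := by
    rw [Matrix.IsHermitian, Matrix.conjTranspose_sub, Matrix.conjTranspose_smul, hS.eq,
      Matrix.conjTranspose_one]
    simp
  have h2 : ∑ i, (2 * hS.eigenvalues i - 1) ^ 2 = frobNorm ((2 : ℝ) • S - 1) ^ 2 := by
    rw [← sum_norm_sq_orthonormalBasis h1 hS.eigenvectorBasis]
    refine Finset.sum_congr rfl fun i _ => ?_
    have : Matrix.toEuclideanCLM (𝕜 := ℝ) ((2 : ℝ) • S - 1) (hS.eigenvectorBasis i)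
        = (2 * hS.eigenvalues i - 1) • hS.eigenvectorBasis i := by
      rw [map_sub, map_smul, map_one, sub_smul, mul_smul, ← toEuclideanCLM_eigenvectorBasis hS,
        one_smul]
      rfl
    rw [this, norm_smul, hS.eigenvectorBasis.norm_eq_one, mul_one, Real.norm_eq_abs, sq_abs]
  refine ⟨h2, fun i => le_trans ?_ (h2.trans_le h)⟩
  exact Finset.single_le_sum (f := fun i => (2 * hS.eigenvalues i - 1) ^ 2)
    (fun i _ => sq_nonneg _) (Finset.mem_univ i)

lemma mem_covSet_of_near_half {S : Mat d} (hS : S.IsHermitian)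
    (h : frobNorm ((2 : ℝ) • S - 1) ^ 2 ≤ 1 / 4) : S ∈ covSet d := by
  have h1 := (eigenvalues_near_half hS h).2
  refine ⟨hS.posDef_iff_eigenvalues_pos.2 fun i => by nlinarith [h1 i], ?_⟩
  have e1 : S = Matrix.diagonal (fun _ => 1 / 2) + (1 / 2 : ℝ) • ((2 : ℝ) • S - 1) := by
    rw [smul_sub, smul_smul, ← Matrix.smul_one_eq_diagonal]
    norm_num
  have h2 : frobNorm ((2 : ℝ) • S - 1) ≤ 1 / 2 :=
    abs_le_of_sq_le_sq' (by linarith) (by norm_num) |>.2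
  rw [e1]
  refine (opNorm_add_le _ _).trans ?_
  have h3 : opNorm (Matrix.diagonal (fun _ : Fin d => (1 / 2 : ℝ))) ≤ 1 / 2 :=
    opNorm_diagonal_le (by norm_num) fun i => by norm_num
  have h4 := opNorm_le_frobNorm ((1 / 2 : ℝ) • ((2 : ℝ) • S - 1))
  rw [frobNorm_smul, abs_of_pos (by norm_num : (0 : ℝ) < 1 / 2)] at h4
  linarith

/-- An eigenbasis of `S` also diagonalizes `I/2`, so both Gaussians are images of product measures
under one map and the scalar comparison tensorizes, over coordinates and then over the sample. The
exponents add up to `∑ (2λ_i - 1)² = ‖2S - I‖_F²` per observation. -/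
lemma chiSqLe_sampleLaw {S : Mat d} (n : ℕ) (hS : S.IsHermitian)
    (h : frobNorm ((2 : ℝ) • S - 1) ^ 2 ≤ 1 / 4) :
    ChiSqLe (ENNReal.ofReal (Real.exp (n * frobNorm ((2 : ℝ) • S - 1) ^ 2))) (sampleLaw n S)
      (sampleLaw n ((1 / 2 : ℝ) • 1)) := by
  obtain ⟨h1, h2⟩ := eigenvalues_near_half hS h
  have hpos := (mem_covSet_of_near_half hS h).1
  set s := hS.eigenvalues with hs
  set b := hS.eigenvectorBasis
  have hs0 : ∀ i, 0 ≤ (1 + (2 * s i - 1)) / 2 := fun i => by nlinarith [h2 i]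
  have hP : multivariateGaussian 0 S = (Measure.pi fun i => gaussianReal 0
      ((1 + (2 * s i - 1)) / 2).toNNReal).map fun x => ∑ i, x i • b i := by
    refine multivariateGaussian_eq_map_pi hpos.posSemidef b _ fun i => ?_
    rw [Real.coe_toNNReal _ (hs0 i), toEuclideanCLM_eigenvectorBasis]
    congr 1
    ring
  have hQ : multivariateGaussian 0 ((1 / 2 : ℝ) • (1 : Mat d)) = (Measure.pi fun _ : Fin d =>
      gaussianReal 0 (1 / 2)).map fun x => ∑ i, x i • b i := by
    refine multivariateGaussian_eq_map_pi (Matrix.PosSemidef.one.smul (by norm_num)) b _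
      fun i => ?_
    rw [toEuclideanCLM_smul_one]
    norm_num
  have h3 : ChiSqLe (∏ i, ENNReal.ofReal (Real.exp ((2 * s i - 1) ^ 2)))
      (multivariateGaussian 0 S) (multivariateGaussian 0 ((1 / 2 : ℝ) • (1 : Mat d))) := by
    rw [hP, hQ]
    exact (ChiSqLe.pi fun i => chiSqLe_gaussianReal (h2 i)).map (by fun_prop)
  rw [← ENNReal.ofReal_prod_of_nonneg fun i _ => (Real.exp_pos _).le, ← Real.exp_sum, h1] at h3
  have h4 := ChiSqLe.pi fun _ : Fin n => h3
  rw [Finset.prod_const, Finset.card_univ, Fintype.card_fin,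
    ← ENNReal.ofReal_pow (Real.exp_pos _).le, ← Real.exp_nat_mul] at h4
  exact h4

/-! ### Fano's argument and two hypotheses -/

lemma ChiSqLe.measure_sq_le {X : Type} [MeasurableSpace X] {κ : ℝ≥0∞} {P Q : Measure X}
    (h : ChiSqLe κ P Q) {A : Set X} (hA : MeasurableSet A) : P A ^ 2 ≤ κ * Q A := by
  have := h (A.indicator 1) (measurable_one.indicator hA)
  have e : ∀ x, A.indicator (1 : X → ℝ≥0∞) x ^ 2 = A.indicator 1 x := fun x => by
    by_cases hx : x ∈ A <;> simp [hx]
  simp_rw [e] at this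
  rwa [lintegral_indicator_one hA, lintegral_indicator_one hA] at this

lemma chiSqLe_dirac {X : Type} [MeasurableSpace X] (x : X) :
    ChiSqLe 1 (Measure.dirac x) (Measure.dirac x) := fun f hf => by
  rw [lintegral_dirac' _ hf, lintegral_dirac' _ (hf.pow_const 2), one_mul]

/-- A version of Fano's inequality with the `χ²`-divergence: if the laws of the hypotheses `Θ` are
close to a common law and every guess is good for few hypotheses, then some hypothesis is
guessed badly with probability at least `1/10`. -/
lemma exists_measure_le_of_chiSqLe {X ι : Type} [MeasurableSpace X] {Θ : Finset ι}
    (hΘ : Θ.Nonempty) {P : ι → Measure X} [∀ i, IsProbabilityMeasure (P i)] {Q : Measure X}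
    [IsProbabilityMeasure Q] {κ K : ℝ} (hκ : 0 ≤ κ)
    (h : ∀ i ∈ Θ, ChiSqLe (ENNReal.ofReal κ) (P i) Q) {A : ι → Set X}
    (hA : ∀ i, MeasurableSet (A i)) [∀ x, DecidablePred fun i => x ∈ A i]
    (hK : ∀ x, ((Θ.filter fun i => x ∈ A i).card : ℝ) ≤ K) (hKΘ : κ * K ≤ 81 / 100 * Θ.card) :
    ∃ i ∈ Θ, (P i).real (A i) ≤ 9 / 10 := by
  -- Each `P_i(A_i)²` is at most `κ Q(A_i)`, and the `Q(A_i)` sum to the mean number of hypotheses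
  -- for which the observation is good, at most `K`. If every `P_i(A_i)` exceeded `9/10`, then
  -- `(81/100)|Θ| < κ K`.
  by_contra! hcon
  have h1 : ∀ i ∈ Θ, (P i).real (A i) ^ 2 ≤ κ * Q.real (A i) := fun i hi => by
    have := ENNReal.toReal_mono (by finiteness) ((h i hi).measure_sq_le (hA i))
    rwa [ENNReal.toReal_pow, ENNReal.toReal_mul, ENNReal.toReal_ofReal hκ] at this
  have h2 : ∑ i ∈ Θ, Q.real (A i) ≤ K := by
    have e : ∀ i, Q.real (A i) = ∫ x, (A i).indicator (fun _ => (1 : ℝ)) x ∂Q := fun i =>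
      (integral_indicator_one (hA i)).symm
    simp_rw [e]
    rw [← integral_finsetSum _ fun i _ => (integrable_const (1 : ℝ)).indicator (hA i)]
    have : ∀ x, ∑ i ∈ Θ, (A i).indicator (fun _ => (1 : ℝ)) x ≤ K := fun x => by
      refine le_trans (le_of_eq ?_) (hK x)
      rw [Finset.card_filter]
      push_cast
      exact Finset.sum_congr rfl fun i _ => by simp [Set.indicator_apply]
    refine (integral_mono (integrable_finsetSum _ fun i _ =>
      (integrable_const (1 : ℝ)).indicator (hA i)) (integrable_const K) this).trans_eq ?_
    simp
  have h3 : ∑ i ∈ Θ, (81 / 100 : ℝ) < ∑ i ∈ Θ, κ * Q.real (A i) :=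
    Finset.sum_lt_sum_of_nonempty hΘ fun i hi => by nlinarith [hcon i hi, h1 i hi]
  rw [Finset.sum_const, nsmul_eq_mul, ← Finset.mul_sum] at h3
  nlinarith [mul_le_mul_of_nonneg_left h2 hκ]

-- The oracle returns `S` itself, the same for every `π`, so it says nothing about `π`. Permuting
-- leaves `‖2S - I‖_F` unchanged, so one `κ` serves all hypotheses. A failure of probability `1/10`
-- costs at least `r` each time.
open scoped Classical in
lemma ofReal_div_ten_le_oracleRisk {m n : ℕ} (e : Estimator (OracleObs d n) d) {S : Mat d}
    (hS : S.IsHermitian) (h : frobNorm ((2 : ℝ) • S - 1) ^ 2 ≤ 1 / 4)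
    {Θ : Finset (Equiv.Perm (Fin d))} (hΘ : Θ.Nonempty) {r K : ℝ} (hr : 0 ≤ r)
    (hK : ∀ ρ : Equiv.Perm (Fin d),
      ((Θ.filter fun π => frobNorm (permute ρ S - permute π S) ^ 2 < r).card : ℝ) ≤ K)
    (hKΘ : Real.exp (n * frobNorm ((2 : ℝ) • S - 1) ^ 2) * K ≤ 81 / 100 * Θ.card) :
    ENNReal.ofReal (r / 10) ≤ oracleRisk m n e := by
  let P : Equiv.Perm (Fin d) → Measure (OracleObs d n) := fun π =>
    (sampleLaw n (permute π S)).prod (Measure.dirac S)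
  let A : Equiv.Perm (Fin d) → Set (OracleObs d n) := fun π =>
    {z | frobNorm (permute (e.toFun z) S - permute π S) ^ 2 < r}
  have hA : ∀ π, MeasurableSet (A π) := fun π =>
    measurableSet_lt (e.measurable_comp fun ρ => frobNorm (permute ρ S - permute π S) ^ 2)
      measurable_const
  have hP : ∀ π ∈ Θ, ChiSqLe (ENNReal.ofReal (Real.exp (n * frobNorm ((2 : ℝ) • S - 1) ^ 2)))
      (P π) ((sampleLaw n ((1 / 2 : ℝ) • 1)).prod (Measure.dirac S)) := by
    intro π _
    have e1 : (2 : ℝ) • permute π S - 1 = permute π ((2 : ℝ) • S - 1) := by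
      ext i j
      simp [Matrix.one_apply]
    have e2 : frobNorm ((2 : ℝ) • permute π S - 1) = frobNorm ((2 : ℝ) • S - 1) := by
      rw [e1, frobNorm_permute]
    have := chiSqLe_sampleLaw n (hS.submatrix π) (by rw [← permute_eq_submatrix, e2]; exact h)
    rw [← permute_eq_submatrix, e2] at this
    simpa only [mul_one] using this.prod (chiSqLe_dirac S)
  obtain ⟨π, -, hπ⟩ := exists_measure_le_of_chiSqLe hΘ (Real.exp_pos _).le hP hA
    (fun z => hK (e.toFun z)) hKΘ
  have hT : opNorm (S - S) ≤ √((d : ℝ) / m) := by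
    rw [sub_self, opNorm, map_zero, norm_zero]; exact Real.sqrt_nonneg _
  refine le_trans ?_ (le_oracleRisk e π (mem_covSet_of_near_half hS h) hT)
  have h1 : ENNReal.ofReal (1 / 10) ≤ P π (A π)ᶜ := by
    rw [← ofReal_measureReal, probReal_compl_eq_one_sub (hA π)]
    exact ENNReal.ofReal_le_ofReal (by linarith)
  calc ENNReal.ofReal (r / 10) = ENNReal.ofReal r * ENNReal.ofReal (1 / 10) := by
        rw [← ENNReal.ofReal_mul hr]; congr 1; ring
    _ ≤ ENNReal.ofReal r * P π (A π)ᶜ := by gcongr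
    _ = ∫⁻ z, (A π)ᶜ.indicator (fun _ => ENNReal.ofReal r) z ∂(P π) :=
        (lintegral_indicator_const (hA π).compl _).symm
    _ ≤ _ := by
      refine lintegral_mono fun z => ?_
      by_cases hz : z ∈ A π
      · simp [hz]
      · rw [Set.indicator_of_mem (by exact hz)]
        exact ENNReal.ofReal_le_ofReal (not_lt.1 hz)

lemma frobNorm_sub_sq_lt {A B C : Mat d} {r : ℝ} (h1 : frobNorm (A - B) ^ 2 < r)
    (h2 : frobNorm (A - C) ^ 2 < r) : frobNorm (B - C) ^ 2 < 4 * r := by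
  have h3 := frobNorm_sub_le_sub_add_sub B A C
  rw [frobNorm_sub_comm B A] at h3
  nlinarith [sq_nonneg (frobNorm (A - B) - frobNorm (A - C)), frobNorm_nonneg (B - C)]

/-- The two-point lower bound. -/
lemma inv_le_oracleRisk {m n : ℕ} (hd : 2 ≤ d) (hn : 0 < n) (e : Estimator (OracleObs d n) d) :
    ENNReal.ofReal (1 / (640 * n)) ≤ oracleRisk m n e := by
  classical
  have hn' : (1 : ℝ) ≤ n := by exact_mod_cast hn
  have hn0 : (0 : ℝ) < n := by linarith
  let a : Fin d := ⟨0, by omega⟩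
  let b : Fin d := ⟨1, by omega⟩
  have hab : a ≠ b := by simp [a, b]
  -- Then `n ‖2S - I‖_F² = 1/4`, and two hypotheses with `K = 1` need only `exp(1/4) ≤ 1.62`.
  set η : ℝ := √(1 / (16 * n)) with hη
  have hη2 : η ^ 2 = 1 / (16 * n) := Real.sq_sqrt (by positivity)
  set S : Mat d := (1 / 2 : ℝ) • 1 + η • Matrix.single a a 1 with hS
  have hSh : S.IsHermitian := by
    rw [Matrix.IsHermitian, hS]
    simp
  have hnorm : frobNorm ((2 : ℝ) • S - 1) ^ 2 = 1 / (4 * n) := by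
    have : (2 : ℝ) • S - 1 = (2 * η) • Matrix.single a a (1 : ℝ) := by
      rw [hS, smul_add, smul_smul, smul_smul]
      norm_num
    rw [this, frobNorm_smul, frobNorm_single, mul_one, sq_abs, mul_pow, hη2]
    field_simp
    norm_num
  have hdiff : η ^ 2 ≤ frobNorm (permute 1 S - permute (Equiv.swap a b) S) ^ 2 := by
    rw [frobNorm_sq]
    have h1 : η ^ 2 = (permute 1 S - permute (Equiv.swap a b) S) a a ^ 2 := by
      simp [hS, hab]
    rw [h1]
    refine le_trans ?_ (Finset.single_le_sum (f := fun i => ∑ j,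
      (permute 1 S - permute (Equiv.swap a b) S) i j ^ 2)
      (fun i _ => Finset.sum_nonneg fun j _ => sq_nonneg _) (Finset.mem_univ a))
    exact Finset.single_le_sum (f := fun j =>
      (permute 1 S - permute (Equiv.swap a b) S) a j ^ 2)
      (fun j _ => sq_nonneg _) (Finset.mem_univ a)
  have hne : (1 : Equiv.Perm (Fin d)) ≠ Equiv.swap a b := fun h => hab (by
    have := congrArg (fun σ : Equiv.Perm (Fin d) => σ a) h
    simpa using this)
  have key := ofReal_div_ten_le_oracleRisk (m := m) e hSh
    (by rw [hnorm, div_le_div_iff₀ (by positivity) (by norm_num)]; linarith)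
    (Θ := {1, Equiv.swap a b}) (by simp) (r := η ^ 2 / 4) (K := 1) (by positivity) ?_ ?_
  · rw [hη2] at key
    convert key using 2
    field_simp
    norm_num
  · intro ρ
    rw [← Nat.cast_one, Nat.cast_le, Finset.card_le_one]
    have hno : ¬(frobNorm (permute ρ S - permute 1 S) ^ 2 < η ^ 2 / 4 ∧
        frobNorm (permute ρ S - permute (Equiv.swap a b) S) ^ 2 < η ^ 2 / 4) := fun h => by
      have := frobNorm_sub_sq_lt h.1 h.2
      linarith
    intro π hπ π' hπ'
    simp only [Finset.mem_filter, Finset.mem_insert, Finset.mem_singleton] at hπ hπ'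
    obtain ⟨rfl | rfl, h1⟩ := hπ <;> obtain ⟨rfl | rfl, h2⟩ := hπ'
    · rfl
    · exact absurd ⟨h1, h2⟩ hno
    · exact absurd ⟨h2, h1⟩ hno
    · rfl
  · rw [hnorm, Finset.card_pair hne, mul_one]
    have e1 : (n : ℝ) * (1 / (4 * n)) = 1 / 4 := by field_simp
    rw [e1]
    have h1 : Real.exp (1 / 4) ^ 4 = Real.exp 1 := by
      rw [← Real.exp_nat_mul]; norm_num
    have h2 := Real.exp_one_lt_d9
    by_contra! hcon
    have h3 := pow_le_pow_left₀ (by norm_num) hcon.le 4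
    rw [h1] at h3
    norm_num at h3
    linarith

/-! ### Counting permutations, and the lower bound `d log d / n` -/

lemma card_perm_fixing (A : Finset (Fin d)) :
    (Finset.univ.filter fun σ : Equiv.Perm (Fin d) => ∀ i, i ∉ A → σ i = i).card
      = A.card.factorial := by
  rw [← Fintype.card_subtype,
    ← Fintype.card_congr (Equiv.Perm.subtypeEquivSubtypePerm fun i => i ∈ A),
    Fintype.card_perm, Fintype.card_coe]

/-- Union bound over the `h`-subsets of fixed points: `C(a, h) (a - h)! = a!/h!` with `a = |A|`. -/
lemma card_perm_many_fixed_mul_factorial_le (A : Finset (Fin d)) {h : ℕ} (hA : h ≤ A.card) :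
    (Finset.univ.filter fun σ : Equiv.Perm (Fin d) => (∀ i, i ∉ A → σ i = i) ∧
      h ≤ (A.filter fun i => σ i = i).card).card * h.factorial ≤ A.card.factorial := by
  have h1 : (Finset.univ.filter fun σ : Equiv.Perm (Fin d) => (∀ i, i ∉ A → σ i = i) ∧
      h ≤ (A.filter fun i => σ i = i).card) ⊆ (A.powersetCard h).biUnion fun T =>
        Finset.univ.filter fun σ : Equiv.Perm (Fin d) => ∀ i, i ∉ A \ T → σ i = i := by
    intro σ hσ
    rw [Finset.mem_filter] at hσ
    obtain ⟨T, hT, hcard⟩ := Finset.exists_subset_card_eq hσ.2.2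
    rw [Finset.mem_biUnion]
    refine ⟨T, Finset.mem_powersetCard.2 ⟨hT.trans (Finset.filter_subset _ _), hcard⟩, ?_⟩
    rw [Finset.mem_filter]
    refine ⟨Finset.mem_univ _, fun i hi => ?_⟩
    by_cases hiA : i ∈ A
    · have hiT : i ∈ T := by
        by_contra hiT
        exact hi (Finset.mem_sdiff.2 ⟨hiA, hiT⟩)
      exact (Finset.mem_filter.1 (hT hiT)).2
    · exact hσ.2.1 i hiA
  have h2 := (Finset.card_le_card h1).trans Finset.card_biUnion_le
  have h3 : ∀ T ∈ A.powersetCard h, (Finset.univ.filter fun σ : Equiv.Perm (Fin d) =>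
      ∀ i, i ∉ A \ T → σ i = i).card = (A.card - h).factorial := by
    intro T hT
    obtain ⟨hTA, hTc⟩ := Finset.mem_powersetCard.1 hT
    rw [card_perm_fixing, Finset.card_sdiff_of_subset hTA, hTc]
  rw [Finset.sum_congr rfl h3, Finset.sum_const, Finset.card_powersetCard, smul_eq_mul] at h2
  calc _ ≤ (A.card.choose h * (A.card - h).factorial) * h.factorial := Nat.mul_le_mul_right _ h2
    _ = A.card.choose h * h.factorial * (A.card - h).factorial := by ring
    _ = _ := Nat.choose_mul_factorial_mul_factorial hA

/-- From `h! ≥ (h/e)^h`. The threshold on `d` gives `d/25 ≥ e²`, hence `log h - 1 ≥ log (d/5) - 1 ≥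
(log d)/2`, so the exponent is at least `d log d / 10`. -/
lemma exp_le_factorial {h : ℕ} (hd : 400 ≤ d) (hh : d ≤ 5 * h) :
    Real.exp (1 / 25 * (d * Real.log d)) ≤ 81 / 100 * h.factorial := by
  have hd' : (400 : ℝ) ≤ d := by exact_mod_cast hd
  have hh' : (d : ℝ) ≤ 5 * h := by exact_mod_cast hh
  have hh0 : (0 : ℝ) < h := by linarith
  have he : Real.exp 2 ≤ 8 := by
    have h1 := Real.exp_one_lt_d9
    have h2 : Real.exp 2 = Real.exp 1 ^ 2 := by rw [← Real.exp_nat_mul]; norm_num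
    rw [h2]
    nlinarith [Real.exp_pos 1]
  have hlog : 2 ≤ Real.log (d / 25) := by
    rw [Real.le_log_iff_exp_le (by positivity)]
    linarith
  have hlog2 : Real.log d = Real.log (d / 25) + 2 * Real.log 5 := by
    rw [Real.log_div (by positivity) (by norm_num), show (25 : ℝ) = 5 ^ 2 by norm_num,
      Real.log_pow]
    push_cast; ring
  have hlog3 : Real.log d - Real.log 5 ≤ Real.log h := by
    rw [← Real.log_div (by positivity) (by norm_num)]
    exact Real.log_le_log (by positivity) (by linarith)
  have hlog5 : 0 ≤ Real.log 5 := Real.log_nonneg (by norm_num)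
  have h1 : Real.exp (h * (Real.log h - 1)) ≤ h.factorial := by
    have := Real.pow_div_factorial_le_exp (h : ℝ) hh0.le h
    rw [div_le_iff₀ (by positivity)] at this
    rw [mul_sub, Real.exp_sub, mul_comm (h : ℝ), Real.exp_mul, Real.exp_log hh0, mul_one,
      Real.rpow_natCast, div_le_iff₀ (Real.exp_pos _), mul_comm]
    exact this
  have h2 : 1 / 25 * (d * Real.log d) + 1 ≤ h * (Real.log h - 1) := by
    have h3 : (d : ℝ) / 5 * (Real.log d / 2) ≤ h * (Real.log h - 1) :=
      mul_le_mul (by linarith) (by linarith) (by linarith) hh0.le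
    have h4 : (400 : ℝ) * 2 ≤ d * Real.log d :=
      mul_le_mul hd' (by linarith) (by norm_num) (by linarith)
    linarith
  have h3 : Real.exp 1 * Real.exp (1 / 25 * (d * Real.log d)) ≤ h.factorial := by
    rw [← Real.exp_add, add_comm]
    exact (Real.exp_le_exp.2 h2).trans h1
  have h4 := Real.exp_one_gt_d9
  nlinarith [Real.exp_pos (1 / 25 * (d * Real.log d))]

/-- The covariance matrix correlating each coordinate with its mirror image. -/
noncomputable def mirrorCov (d : ℕ) (η : ℝ) : Mat d :=
  Matrix.of fun i j => (if i = j then 1 / 2 else 0) + if j = i.rev then η else 0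

lemma mirrorCov_isHermitian (η : ℝ) : (mirrorCov d η).IsHermitian := by
  ext i j
  have h1 : (j = i.rev) = (i = j.rev) := propext ⟨fun h => by simp [h], fun h => by simp [h]⟩
  simp [mirrorCov, Matrix.conjTranspose_apply, h1, eq_comm]

lemma frobNorm_mirrorCov (η : ℝ) : frobNorm ((2 : ℝ) • mirrorCov d η - 1) ^ 2 = 4 * η ^ 2 * d := by
  rw [frobNorm_sq]
  have h1 : ∀ i j : Fin d, ((2 : ℝ) • mirrorCov d η - 1) i j ^ 2
      = if j = i.rev then 4 * η ^ 2 else 0 := by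
    intro i j
    simp only [mirrorCov, Matrix.sub_apply, Matrix.smul_apply, Matrix.of_apply, Matrix.one_apply,
      smul_eq_mul]
    split_ifs <;> ring
  simp_rw [h1]
  simp [mul_comm]

lemma frobNorm_permute_mirrorCov_sub (η : ℝ) {π π' : Equiv.Perm (Fin d)}
    (hπ : ∀ i : Fin d, ¬i.val < d / 2 → π i = i) (hπ' : ∀ i : Fin d, ¬i.val < d / 2 → π' i = i) :
    η ^ 2 * ((Finset.univ.filter fun i : Fin d => i.val < d / 2).filter
      fun i => π i ≠ π' i).card
      ≤ frobNorm (permute π (mirrorCov d η) - permute π' (mirrorCov d η)) ^ 2 := by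
  have hmaps : ∀ σ : Equiv.Perm (Fin d), (∀ i : Fin d, ¬i.val < d / 2 → σ i = i) →
      ∀ i : Fin d, i.val < d / 2 → (σ i).val < d / 2 := by
    intro σ hσ i hi
    by_contra hcon
    have := σ.injective (hσ _ hcon)
    rw [this] at hcon
    exact hcon hi
  rw [frobNorm_sq, mul_comm, ← nsmul_eq_mul, ← Finset.sum_const]
  refine le_trans (Finset.sum_le_sum fun i hi => ?_) (Finset.sum_le_sum_of_subset_of_nonneg
    (Finset.subset_univ _) fun i _ _ => Finset.sum_nonneg fun j _ => sq_nonneg _)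
  simp only [Finset.mem_filter, Finset.mem_univ, true_and] at hi
  obtain ⟨hi, hne⟩ := hi
  have h1 := hmaps π hπ i hi
  have h2 := hmaps π' hπ' i hi
  -- The column `(π i).rev` lies in the half fixed by both permutations. There row `i` of the first
  -- matrix has the entry `η`, and of the second `0`, because `π' i` is neither `π i` nor its mirror
  -- image.
  have hrev : ¬((π i).rev.val < d / 2) := by rw [Fin.val_rev]; omega
  refine le_trans (le_of_eq ?_) (Finset.single_le_sum
    (f := fun j => (permute π (mirrorCov d η) - permute π' (mirrorCov d η)) i j ^ 2)
    (fun j _ => sq_nonneg _) (Finset.mem_univ (π i).rev))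
  have h3 : π i ≠ (π i).rev := fun h => hrev (h ▸ h1)
  have h4 : π' i ≠ (π i).rev := fun h => hrev (h ▸ h2)
  simp only [Matrix.sub_apply, permute_apply, hπ _ hrev, hπ' _ hrev]
  simp [mirrorCov, h3, h4, Fin.rev_inj, hne]

/-- The lower bound caused by the noise of the sample in large dimension. -/
lemma dim_mul_log_div_le_oracleRisk_of_le {m n : ℕ} (hd : 400 ≤ d)
    (hn : (d : ℝ) * Real.log d ≤ n) (e : Estimator (OracleObs d n) d) :
    ENNReal.ofReal (d * Real.log d / n / 24000) ≤ oracleRisk m n e := by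
  classical
  have hL := one_le_mul_log (d := d) (by omega)
  have hd0 : (0 : ℝ) < d := by positivity
  have hn0 : (0 : ℝ) < n := by linarith
  have hlog : 0 ≤ Real.log d := Real.log_natCast_nonneg d
  -- This makes `n ‖2S - I‖_F² = 4 n η² d = d log d / 25`, the exponent allowed by
  -- `exp_le_factorial`; `n ≥ d log d` keeps `‖2S - I‖_F²` below `1/4`.
  set η : ℝ := √(Real.log d / (100 * n)) with hη
  have hη2 : η ^ 2 = Real.log d / (100 * n) := Real.sq_sqrt (by positivity)
  set A : Finset (Fin d) := Finset.univ.filter fun i => i.val < d / 2 with hA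
  have hAmem : ∀ i, i ∈ A ↔ i.val < d / 2 := fun i => by simp [hA]
  have hAcard : A.card = d / 2 := by rw [hA, Fin.card_filter_val_lt]; omega
  set h : ℕ := (d / 2 + 1) / 2 with hh
  set Θ : Finset (Equiv.Perm (Fin d)) := Finset.univ.filter fun σ => ∀ i, i ∉ A → σ i = i with hΘ
  have hΘmem : ∀ σ, σ ∈ Θ ↔ ∀ i : Fin d, ¬i.val < d / 2 → σ i = i := fun σ => by
    simp only [hΘ, Finset.mem_filter, Finset.mem_univ, true_and, hAmem]
  have hΘcard : Θ.card = (d / 2).factorial := by rw [hΘ, card_perm_fixing, hAcard]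
  set G : Finset (Equiv.Perm (Fin d)) := Finset.univ.filter fun σ => (∀ i, i ∉ A → σ i = i) ∧
      h ≤ (A.filter fun i => σ i = i).card with hG
  have hGcard : G.card * h.factorial ≤ (d / 2).factorial := by
    rw [← hAcard]
    exact card_perm_many_fixed_mul_factorial_le A (by omega)
  have hnorm := frobNorm_mirrorCov (d := d) η
  set r : ℝ := η ^ 2 * (d / 2 : ℕ) / 8 with hr
  have key := ofReal_div_ten_le_oracleRisk (m := m) e (mirrorCov_isHermitian (d := d) η) ?_
    (Θ := Θ) ⟨1, by simp [hΘ]⟩ (r := r) (K := G.card) (by positivity) ?_ ?_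
  · refine le_trans (ENNReal.ofReal_le_ofReal ?_) key
    have h1 : d ≤ 3 * (d / 2) := by omega
    have h2 : (d : ℝ) ≤ 3 * ((d / 2 : ℕ) : ℝ) := by exact_mod_cast h1
    have h3 : η ^ 2 * (d / 3) ≤ η ^ 2 * (d / 2 : ℕ) :=
      mul_le_mul_of_nonneg_left (by linarith) (sq_nonneg _)
    have h4 : η ^ 2 * (d / 3) = d * Real.log d / n / 300 := by rw [hη2]; field_simp; ring
    rw [hr]
    linarith
  · rw [hnorm, hη2]
    have h1 : 4 * (Real.log d / (100 * n)) * d = 1 / 25 * (d * Real.log d / n) := by ring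
    have h2 : (d : ℝ) * Real.log d / n ≤ 1 := (div_le_one hn0).2 hn
    rw [h1]
    linarith
  · intro ρ
    rw [Nat.cast_le]
    rcases (Θ.filter fun π => frobNorm (permute ρ (mirrorCov d η)
      - permute π (mirrorCov d η)) ^ 2 < r).eq_empty_or_nonempty with hemp | ⟨π₀, hπ₀⟩
    · rw [hemp]; simp
    · rw [Finset.mem_filter] at hπ₀
      -- Two permutations good for the same guess are within `4r` of each other in squared distance,
      -- so they differ on fewer than half of the points of `A`. Dividing by one good `π₀` maps all
      -- good ones injectively into the permutations with at least `h` fixed points in `A`.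
      refine Finset.card_le_card_of_injOn (fun π => π₀⁻¹ * π) (fun π hπ => ?_)
        (fun π _ π' _ hππ' => mul_left_cancel hππ')
      rw [Finset.mem_coe, Finset.mem_filter] at hπ
      have h0 := (hΘmem π₀).1 hπ₀.1
      have h1 := (hΘmem π).1 hπ.1
      have h2 := (frobNorm_permute_mirrorCov_sub η h1 h0).trans_lt
        (frobNorm_sub_sq_lt hπ.2 hπ₀.2)
      rw [← hA] at h2
      have h3 : (A.filter fun i => π i ≠ π₀ i).card < h := by
        have hη0 : 0 < η ^ 2 := by
          rcases (sq_nonneg η).eq_or_lt with h4 | h4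
          · rw [hr, ← h4] at h2; simp at h2
          · exact h4
        have h4 : ((A.filter fun i => π i ≠ π₀ i).card : ℝ) < (d / 2 : ℕ) / 2 := by
          rw [hr] at h2
          refine lt_of_mul_lt_mul_left (h2.trans_eq ?_) hη0.le
          ring
        have h5 : (((2 * (A.filter fun i => π i ≠ π₀ i).card : ℕ)) : ℝ) < (d / 2 : ℕ) := by
          push_cast; linarith
        have h6 := Nat.cast_lt.1 h5
        omega
      have h4 := Finset.card_filter_add_card_filter_not (s := A) fun i => π i = π₀ i
      change _ + (A.filter fun i => π i ≠ π₀ i).card = _ at h4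
      have h5 : (A.filter fun i => (π₀⁻¹ * π) i = i) = A.filter fun i => π i = π₀ i :=
        Finset.filter_congr fun i _ => by
          rw [Equiv.Perm.mul_apply, Equiv.Perm.inv_eq_iff_eq]
      rw [Finset.mem_coe, hG, Finset.mem_filter, h5]
      refine ⟨Finset.mem_univ _, fun i hi => ?_, by omega⟩
      rw [hAmem] at hi
      rw [Equiv.Perm.mul_apply, h1 i hi, Equiv.Perm.inv_eq_iff_eq, h0 i hi]
  · rw [hnorm, hη2, hΘcard]
    have h1 : (n : ℝ) * (4 * (Real.log d / (100 * n)) * d) = 1 / 25 * (d * Real.log d) := by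
      field_simp; ring
    rw [h1]
    have h2 := exp_le_factorial hd (h := h) (by omega)
    calc _ ≤ 81 / 100 * (h.factorial : ℝ) * G.card :=
          mul_le_mul_of_nonneg_right h2 (Nat.cast_nonneg _)
      _ = 81 / 100 * ((G.card * h.factorial : ℕ) : ℝ) := by push_cast; ring
      _ ≤ _ := by gcongr

/-! ### The minimax lower bound and the theorem -/

theorem dim_mul_log_div_le_oracleRisk {m n : ℕ} (hd : 2 ≤ d)
    (hn : (d : ℝ) * Real.log d ≤ n) (e : Estimator (OracleObs d n) d) :
    ENNReal.ofReal (d * Real.log d / n / 10 ^ 9) ≤ oracleRisk m n e := by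
  have hL := one_le_mul_log hd
  have hn0 : (0 : ℝ) < n := by linarith
  rcases le_or_gt 400 d with h | h
  · refine le_trans (ENNReal.ofReal_le_ofReal ?_) (dim_mul_log_div_le_oracleRisk_of_le h hn e)
    have : 0 ≤ (d : ℝ) * Real.log d / n := by positivity
    linarith
  -- For bounded `d` the factor `d log d` is bounded, and the two-point bound of order `1/n`
  -- suffices.
  · refine le_trans (ENNReal.ofReal_le_ofReal ?_)
      (inv_le_oracleRisk hd (by exact_mod_cast hn0) e)
    have hd' : (d : ℝ) ≤ 400 := by exact_mod_cast h.le
    have hd0 : (2 : ℝ) ≤ d := by exact_mod_cast hd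
    have h1 : Real.log d ≤ 400 := (Real.log_le_self (by linarith)).trans hd'
    have h2 : (d : ℝ) * Real.log d ≤ 400 * 400 :=
      mul_le_mul hd' h1 (Real.log_natCast_nonneg d) (by norm_num)
    rw [div_div, div_le_div_iff₀ (by positivity) (by positivity)]
    nlinarith

theorem oracleRate_le_oracleMinimax {m n : ℕ} (hd : 2 ≤ d) (hmn : n ≤ m)
    (hn : (d : ℝ) * Real.log d ≤ n) :
    ENNReal.ofReal (1 / (2 * 10 ^ 9) * oracleRate d m n) ≤ oracleMinimax d m n := by
  refine le_iInf fun e => ?_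
  have hL := one_le_mul_log hd
  have hn0 : (0 : ℝ) < n := by linarith
  have hmn' : (n : ℝ) ≤ m := by exact_mod_cast hmn
  have hm0 : (0 : ℝ) < m := by linarith
  have hd0 : (2 : ℝ) ≤ d := by exact_mod_cast hd
  have hdm : (d : ℝ) ≤ 2 * m := by
    have h1 := Real.log_two_gt_d9
    have h2 := Real.log_le_log two_pos hd0
    nlinarith
  have h1 := dim_mul_log_div_le_oracleRisk (m := m) hd hn e
  have h2 := dim_sq_div_le_oracleRisk (n := n) hd hdm e
  have h3 : (0 : ℝ) ≤ (d : ℝ) ^ 2 / m := by positivity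
  have h4 : 0 ≤ (d : ℝ) * Real.log d / n := by positivity
  rcases le_total ((d : ℝ) ^ 2 / m) (d * Real.log d / n) with h | h
  · refine le_trans (ENNReal.ofReal_le_ofReal ?_) h1
    rw [oracleRate]
    linarith
  · refine le_trans (ENNReal.ofReal_le_ofReal ?_) h2
    rw [oracleRate]
    linarith

end CovAlign
open CovAlign in
theorem theorem6 :
    -- The minimax rate in the oracle model, attained by the Gromov–Wasserstein estimator.
    (∃ c C : ℝ, 0 < c ∧ 0 < C ∧
      ∀ d m n : ℕ, 2 ≤ d → n ≤ m → (d : ℝ) * Real.log d ≤ n →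
        ENNReal.ofReal (c * oracleRate d m n) ≤ oracleMinimax d m n ∧
        oracleMinimax d m n ≤ ENNReal.ofReal (C * oracleRate d m n) ∧
        (∃ e : Estimator (OracleObs d n) d, IsGW e) ∧
        (∀ e : Estimator (OracleObs d n) d, IsGW e →
          oracleRisk m n e ≤ ENNReal.ofReal (C * oracleRate d m n))) ∧
    -- Up to a constant, the oracle model is never easier than the original model.
    (∃ K : ℝ, 0 < K ∧
      ∀ d m n : ℕ, 2 ≤ d → n ≤ m → (d : ℝ) * Real.log d ≤ n →
        originalMinimax d m n ≤ ENNReal.ofReal K * oracleMinimax d m n) ∧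
    -- It is of strictly larger order: for equal sample sizes the ratio of the minimax risk in the
    -- original model to that in the oracle model tends to zero as the dimension grows.
    (∀ ε : ℝ, 0 < ε → ∃ d₀ : ℕ, ∀ d n : ℕ, 2 ≤ d → d₀ ≤ d → (d : ℝ) * Real.log d ≤ n →
      originalMinimax d n n ≤ ENNReal.ofReal ε * oracleMinimax d n n) := by
  have hc : (0 : ℝ) < 1 / (2 * 10 ^ 9) := by norm_num
  have hlow := fun {d m n : ℕ} => oracleRate_le_oracleMinimax (d := d) (m := m) (n := n)
  set c : ℝ := 1 / (2 * 10 ^ 9)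
  refine ⟨⟨c, 2400, hc, by norm_num, fun d m n hd hmn hn => ?_⟩,
    ⟨4000 / c, by positivity, fun d m n hd hmn hn => ?_⟩, fun ε hε => ?_⟩
  · have hL := one_le_mul_log hd
    have hn0 : (0 : ℝ) < n := by linarith
    have hm : 0 < m := lt_of_lt_of_le (by exact_mod_cast hn0) hmn
    have hup := fun (e : Estimator (OracleObs d n) d) (he : IsGW e) =>
      oracleRisk_le_of_isGW hd hm hn he
    obtain ⟨e, he⟩ := exists_isGW d n
    exact ⟨hlow hd hmn hn, (iInf_le _ e).trans (hup e he), ⟨e, he⟩, hup⟩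
  · have hL := one_le_mul_log hd
    refine (originalMinimax_le hd hmn hn one_pos).trans
      (le_trans ?_ (mul_le_mul_right (hlow hd hmn hn) _))
    rw [← ENNReal.ofReal_mul (by positivity)]
    refine ENNReal.ofReal_le_ofReal ?_
    have h1 : (0 : ℝ) ≤ (d : ℝ) ^ 2 / m := by positivity
    have h2 : 0 ≤ (d : ℝ) * Real.log d / n := by positivity
    rw [← mul_assoc, div_mul_cancel₀ _ hc.ne', oracleRate]
    linarith
  -- The budget `ε c` is halved: `800 s = ε c / 2` handles the `d²/n` term. Then `t` is chosen so
  -- that `log d ≤ t d` brings the noise term below the other half; both terms scale as `1/n`, so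
  -- `d₀` is independent of `n`.
  · set s : ℝ := ε * c / 1600 with hs
    have hs0 : 0 < s := by positivity
    set t : ℝ := ε * c / 2 / (800 * (4 + 1 / s)) with ht
    have ht0 : 0 < t := by positivity
    obtain ⟨x₀, hx₀⟩ := Filter.eventually_atTop.1 (Real.isLittleO_log_id_atTop.def ht0)
    refine ⟨⌈x₀⌉₊, fun d n hd hd₀ hn => ?_⟩
    have hL := one_le_mul_log hd
    have hn0 : (0 : ℝ) < n := by linarith
    have hlog : Real.log d ≤ t * d := by
      have := hx₀ d (Nat.ceil_le.1 hd₀)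
      rw [id, Real.norm_of_nonneg (Nat.cast_nonneg d)] at this
      exact (le_abs_self _).trans this
    refine (originalMinimax_le hd le_rfl hn hs0).trans
      (le_trans ?_ (mul_le_mul_right (hlow hd le_rfl hn) _))
    rw [← ENNReal.ofReal_mul hε.le]
    refine ENNReal.ofReal_le_ofReal ?_
    have h1 : (d : ℝ) * Real.log d / n ≤ t * ((d : ℝ) ^ 2 / n) := by
      rw [← mul_div_assoc]
      refine div_le_div_of_nonneg_right ?_ hn0.le
      calc (d : ℝ) * Real.log d ≤ d * (t * d) := by gcongr
        _ = t * (d : ℝ) ^ 2 := by ring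
    have h2 : 800 * (4 + 1 / s) * t = ε * c / 2 := by
      rw [ht]; field_simp
    have h3 : 800 * (4 + 1 / s) * ((d : ℝ) * Real.log d / n)
        ≤ ε * c / 2 * ((d : ℝ) ^ 2 / n) := by
      rw [← h2, mul_assoc _ t]
      exact mul_le_mul_of_nonneg_left h1 (by positivity)
    have h4 : 800 * s * ((d : ℝ) ^ 2 / n) = ε * c / 2 * ((d : ℝ) ^ 2 / n) := by
      rw [hs]; ring
    have h5 : 0 ≤ ε * c * ((d : ℝ) * Real.log d / n) := by positivity
    rw [oracleRate]
    linarith
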